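/- Let $A$ be a separable (not necessarily unital) $C^*$-algebra and let $B\subset A$ be a Cartan subalgebra: $B$ is an abelian sub-$C^*$-algebra which contains an approximate unit of $A$, is maximal abelian, is regular (the normalizer $N(B)=\{n\in A: nBn^*\subset B,\ n^*Bn\subset B\}$ generates $A$ as a $C^*$-algebra), and admits a faithful conditional expectation of $A$ onto $B$. Let $X=\widehat B$ be the spectrum of $B$. For $n\in N(B)$ put $\mathrm{dom}(n)=\{y\in X: n^*n(y)>0\}$ and $\mathrm{ran}(n)=\{x\in X: nn^*(x)>0\}$, and let $\alpha_n:\mathrm{dom}(n)\to \mathrm{ran}(n)$ be the homeomorphism determined by $(n^*bn)(y)=b(\alpha_n(y))\,n^*n(y)$ for $b\in B$. The Weyl pseudogroup is $\{\alpha_n: n\in N(B)\}$, and the Weyl groupoid $G(B)$ is its groupoid of germs $[x,\alpha_n,y]$ (where $y\in\mathrm{dom}(n)$, $x=\alpha_n(y)$), with unit space $X$ and with the topology of germs, generated by the sets $\{[x,\alpha_n,y]: x\in U,\ y\in V\}$ with $U,V\subset X$ open and $n\in N(B)$. Then $G(B)$ is a Hausdorff étale groupoid: its topology is Hausdorff,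 its structure maps are continuous, the inclusion of the unit space $X$ into $G(B)$ is a homeomorphism onto its image, and its range and source maps are surjective, open, and local homeomorphisms onto $X$. Moreover, for every faithful conditional expectation $P$ of $A$ onto $B$, the evaluated sections separate the points of $G(B)$. Precisely, let $\Sigma(B)$ be the set of classes $[x,n,y]$ of triples with $n\in N(B)$, $n^*n(y)>0$, $x=\alpha_n(y)$, where $(x,n,y)\sim(x',n',y')$ iff $y=y'$ and $nb=n'b'$ for some $b,b'\in B$ with $b(y),b'(y)>0$; map $\Sigma(B)$ to $G(B)$ by $[x,n,y]\mapsto[x,\alpha_n,y]$, and for $a\in A$ let $\hat a([x,n,y])=P(n^*a)(y)/\sqrt{n^*n(y)}$. If $\sigma,\sigma'\in\Sigma(B)$ have different images in $G(B)$, then there is $a\in A$ with $\hat a(\sigma)\neq0$ and $\hat a(\sigma')=0$. -/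

import Mathlib

open Filter Topology
open scoped ComplexOrder

/-! ### Topological and étale groupoids -/

/-- A groupoid with unit space `X` and set of arrows `G`. The product `mul γ γ' h` is defined on
the composable pairs, i.e. those with `s γ = r γ'`. -/
structure ArrowGroupoid (X G : Type*) where
  r : G → X
  s : G → X
  unit : X → G
  inv : G → G
  mul : ∀ γ γ' : G, s γ = r γ' → G
  r_unit : ∀ x, r (unit x) = x
  s_unit : ∀ x, s (unit x) = x
  r_inv : ∀ γ, r (inv γ) = s γ
  s_inv : ∀ γ, s (inv γ) = r γ
  r_mul : ∀ γ γ' h, r (mul γ γ' h) = r γ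
  s_mul : ∀ γ γ' h, s (mul γ γ' h) = s γ'
  mul_assoc : ∀ γ₁ γ₂ γ₃ (h₁₂ : s γ₁ = r γ₂) (h₂₃ : s γ₂ = r γ₃),
    mul (mul γ₁ γ₂ h₁₂) γ₃ ((s_mul γ₁ γ₂ h₁₂).trans h₂₃) =
      mul γ₁ (mul γ₂ γ₃ h₂₃) (h₁₂.trans (r_mul γ₂ γ₃ h₂₃).symm)
  unit_mul : ∀ γ, mul (unit (r γ)) γ (s_unit (r γ)) = γ
  mul_unit : ∀ γ, mul γ (unit (s γ)) (r_unit (s γ)).symm = γ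
  inv_mul : ∀ γ, mul (inv γ) γ (s_inv γ) = unit (s γ)
  mul_inv : ∀ γ, mul γ (inv γ) (r_inv γ).symm = unit (r γ)

namespace ArrowGroupoid

variable {X G : Type*} [TopologicalSpace X] [TopologicalSpace G]

/-- A topological groupoid: the structure maps are continuous, the range and source maps are
surjective and open. The set of composable pairs carries the topology induced by `G × G`, and
`unit` identifies `X` with a subspace of `G`, so that the unit space carries the topology
induced by `G`. -/
structure IsTopological (𝓖 : ArrowGroupoid X G) : Prop where
  continuous_r : Continuous 𝓖.r
  continuous_s : Continuous 𝓖.s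
  isEmbedding_unit : IsEmbedding 𝓖.unit
  continuous_inv : Continuous 𝓖.inv
  continuous_mul : Continuous fun p : {p : G × G // 𝓖.s p.1 = 𝓖.r p.2} =>
    𝓖.mul p.1.1 p.1.2 p.2
  surjective_r : Function.Surjective 𝓖.r
  surjective_s : Function.Surjective 𝓖.s
  isOpenMap_r : IsOpenMap 𝓖.r
  isOpenMap_s : IsOpenMap 𝓖.s

/-- An étale groupoid: a topological groupoid whose range and source maps are local
homeomorphisms onto the unit space. -/
structure IsEtale (𝓖 : ArrowGroupoid X G) : Prop extends IsTopological 𝓖 where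
  isLocalHomeomorph_r : IsLocalHomeomorph 𝓖.r
  isLocalHomeomorph_s : IsLocalHomeomorph 𝓖.s

end ArrowGroupoid

/-! ### Pseudogroups and their groupoids of germs -/

/-- A pseudogroup on `X`: a set of partial homeomorphisms between open subsets of `X` which is
stable under composition and inverse. A partial homeomorphism is determined by its domain and its
values there, whence the field `eqOnSource_mem`. -/
structure Pseudogroup (X : Type*) [TopologicalSpace X] where
  carrier : Set (OpenPartialHomeomorph X X)
  symm_mem : ∀ φ ∈ carrier, φ.symm ∈ carrier
  trans_mem : ∀ φ ∈ carrier, ∀ ψ ∈ carrier, φ.trans ψ ∈ carrier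
  eqOnSource_mem : ∀ φ ∈ carrier, ∀ ψ, φ ≈ ψ → ψ ∈ carrier

namespace Pseudogroup

variable {X : Type*} [TopologicalSpace X] (𝒢 : Pseudogroup X)

/-- Pairs `(φ, y)` with `φ ∈ 𝒢` and `y ∈ dom φ`. -/
structure PreGerm where
  φ : OpenPartialHomeomorph X X
  mem : φ ∈ 𝒢.carrier
  pt : X
  pt_mem : pt ∈ φ.source

/-- `(φ, y)` and `(ψ, y)` are identified iff `φ` and `ψ` agree in a neighbourhood of `y`. -/
instance preGermSetoid : Setoid 𝒢.PreGerm where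
  r p q := p.pt = q.pt ∧ p.φ =ᶠ[𝓝 p.pt] q.φ
  iseqv :=
    { refl := fun _ => ⟨rfl, EventuallyEq.rfl⟩
      symm := fun {_ _} h => ⟨h.1.symm, h.1 ▸ h.2.symm⟩
      trans := fun {_ _ _} h h' => ⟨h.1.trans h'.1, h.2.trans (h.1 ▸ h'.2)⟩ }

/-- The set of germs `[φ y, φ, y]` of elements of the pseudogroup. -/
def Germ : Type _ := Quotient 𝒢.preGermSetoid

variable {𝒢}

/-- The germ `[φ y, φ, y]`. -/
def germ (φ : OpenPartialHomeomorph X X) (hφ : φ ∈ 𝒢.carrier) (y : X) (hy : y ∈ φ.source) :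
    𝒢.Germ := Quotient.mk _ ⟨φ, hφ, y, hy⟩

namespace Germ

theorem exists_rep (g : 𝒢.Germ) :
    ∃ (φ : OpenPartialHomeomorph X X) (hφ : φ ∈ 𝒢.carrier) (y : X) (hy : y ∈ φ.source),
      g = germ φ hφ y hy := by
  obtain ⟨⟨φ, hφ, y, hy⟩, rfl⟩ := Quotient.exists_rep g
  exact ⟨φ, hφ, y, hy, rfl⟩

theorem germ_eq_iff {φ ψ : OpenPartialHomeomorph X X} {hφ : φ ∈ 𝒢.carrier}
    {hψ : ψ ∈ 𝒢.carrier} {y z : X} {hy : y ∈ φ.source} {hz : z ∈ ψ.source} :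
    germ φ hφ y hy = germ ψ hψ z hz ↔ y = z ∧ φ =ᶠ[𝓝 y] ψ :=
  Quotient.eq (r := 𝒢.preGermSetoid)

/-- `s [x, φ, y] = y`. -/
def source : 𝒢.Germ → X := Quotient.lift (fun p => p.pt) fun _ _ h => h.1

/-- `r [x, φ, y] = x = φ y`. -/
def range : 𝒢.Germ → X := Quotient.lift (fun p => p.φ p.pt) fun p q h => by
  have := h.2.self_of_nhds
  rw [this, h.1]

@[simp] theorem source_germ (φ : OpenPartialHomeomorph X X) (hφ : φ ∈ 𝒢.carrier) (y : X)
    (hy : y ∈ φ.source) : (germ φ hφ y hy).source = y := rfl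

@[simp] theorem range_germ (φ : OpenPartialHomeomorph X X) (hφ : φ ∈ 𝒢.carrier) (y : X)
    (hy : y ∈ φ.source) : (germ φ hφ y hy).range = φ y := rfl

theorem symm_eventuallyEq {φ ψ : OpenPartialHomeomorph X X} {y : X} (hy : y ∈ φ.source)
    (hy' : y ∈ ψ.source) (h : φ =ᶠ[𝓝 y] ψ) : φ.symm =ᶠ[𝓝 (φ y)] ψ.symm := by
  have hc : Tendsto φ.symm (𝓝 (φ y)) (𝓝 y) := by
    have := φ.symm.continuousAt (x := φ y) (φ.map_source hy)
    simpa [ContinuousAt, φ.left_inv hy] using this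
  filter_upwards [hc.eventually h, hc.eventually (ψ.open_source.mem_nhds hy'),
    φ.open_target.mem_nhds (φ.map_source hy)] with x h1 h2 h3
  rw [φ.right_inv h3] at h1
  have := ψ.left_inv h2
  rw [← h1] at this
  exact this.symm

theorem apply_mem_symm_source {φ : OpenPartialHomeomorph X X} {y : X} (hy : y ∈ φ.source) :
    φ y ∈ φ.symm.source := φ.map_source hy

/-- `[x, φ, y]⁻¹ = [y, φ⁻¹, x]`. -/
def inv : 𝒢.Germ → 𝒢.Germ :=
  Quotient.lift
    (fun p => germ p.φ.symm (𝒢.symm_mem _ p.mem) (p.φ p.pt) (apply_mem_symm_source p.pt_mem))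
    fun p q h => by
      have h0 : p.φ p.pt = q.φ q.pt := by rw [h.2.self_of_nhds, h.1]
      exact germ_eq_iff.2 ⟨h0, symm_eventuallyEq p.pt_mem (h.1 ▸ q.pt_mem) h.2⟩

@[simp] theorem inv_germ (φ : OpenPartialHomeomorph X X) (hφ : φ ∈ 𝒢.carrier) (y : X)
    (hy : y ∈ φ.source) : (germ φ hφ y hy).inv =
      germ φ.symm (𝒢.symm_mem _ hφ) (φ y) (apply_mem_symm_source hy) := rfl

theorem trans_mem_source {φ ψ : OpenPartialHomeomorph X X} {y z : X} (hy : y ∈ φ.source)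
    (hz : z ∈ ψ.source) (h : y = ψ z) : z ∈ (ψ.trans φ).source := by
  simp only [OpenPartialHomeomorph.trans_source, Set.mem_inter_iff, Set.mem_preimage]
  exact ⟨hz, h ▸ hy⟩

/-- The product of germs, computed on chosen representatives; `germ_mul_germ` shows that
`[x, φ, y] [y, ψ, z] = [x, φ ψ, z]` for all representatives. -/
noncomputable def mul (g g' : 𝒢.Germ) (h : g.source = g'.range) : 𝒢.Germ :=
  germ ((Quotient.out g').φ.trans (Quotient.out g).φ)
    (𝒢.trans_mem _ (Quotient.out g').mem _ (Quotient.out g).mem) (Quotient.out g').pt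
    (trans_mem_source (Quotient.out g).pt_mem (Quotient.out g').pt_mem (by
      have h1 : g.source = (Quotient.out g).pt := by
        conv_lhs => rw [← Quotient.out_eq g]
        rfl
      have h2 : g'.range = (Quotient.out g').φ (Quotient.out g').pt := by
        conv_lhs => rw [← Quotient.out_eq g']
        rfl
      rw [← h1, ← h2, h]))

theorem germ_mul_germ (φ ψ : OpenPartialHomeomorph X X) (hφ : φ ∈ 𝒢.carrier)
    (hψ : ψ ∈ 𝒢.carrier) (y z : X) (hy : y ∈ φ.source) (hz : z ∈ ψ.source) (h : y = ψ z) :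
    mul (germ φ hφ y hy) (germ ψ hψ z hz) h =
      germ (ψ.trans φ) (𝒢.trans_mem _ hψ _ hφ) z (trans_mem_source hy hz h) := by
  have h1 : (Quotient.out (germ φ hφ y hy)) ≈ (⟨φ, hφ, y, hy⟩ : 𝒢.PreGerm) :=
    Quotient.exact (Quotient.out_eq (germ φ hφ y hy))
  have h2 : (Quotient.out (germ ψ hψ z hz)) ≈ (⟨ψ, hψ, z, hz⟩ : 𝒢.PreGerm) :=
    Quotient.exact (Quotient.out_eq (germ ψ hψ z hz))
  obtain ⟨h11, h12⟩ := h1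
  obtain ⟨h21, h22⟩ := h2
  refine germ_eq_iff.2 ⟨h21, ?_⟩
  simp only at h11 h12 h21 h22
  generalize Quotient.out (germ φ hφ y hy) = p at *
  generalize Quotient.out (germ ψ hψ z hz) = q at *
  subst h11 h21
  have h22' : q.φ =ᶠ[𝓝 q.pt] ψ := h22
  have h12' : p.φ =ᶠ[𝓝 (ψ q.pt)] φ := h ▸ h12
  have hc : Tendsto ψ (𝓝 q.pt) (𝓝 (ψ q.pt)) := ψ.continuousAt hz
  filter_upwards [h22', hc.eventually h12'] with w hw1 hw2
  simp only [OpenPartialHomeomorph.coe_trans, Function.comp_apply]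
  rw [hw1, hw2]

/-- The basic open set `{[x, φ, y] : x ∈ U, y ∈ V}`. -/
def basicOpen (U : Set X) (φ : OpenPartialHomeomorph X X) (hφ : φ ∈ 𝒢.carrier) (V : Set X) :
    Set 𝒢.Germ :=
  {g | ∃ (y : X) (hy : y ∈ φ.source), g = germ φ hφ y hy ∧ φ y ∈ U ∧ y ∈ V}

/-- The topology of germs. -/
instance : TopologicalSpace 𝒢.Germ :=
  TopologicalSpace.generateFrom
    {W | ∃ (U V : Set X) (φ : OpenPartialHomeomorph X X) (hφ : φ ∈ 𝒢.carrier),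
      IsOpen U ∧ IsOpen V ∧ W = basicOpen U φ hφ V}

end Germ

/-- The unit at `x`: the germ at `x` of the identity `φ⁻¹ φ` of the domain of any `φ` in the
pseudogroup which is defined at `x`. -/
noncomputable def unitGerm (hcov : ∀ x : X, ∃ φ ∈ 𝒢.carrier, x ∈ φ.source) (x : X) : 𝒢.Germ :=
  germ ((hcov x).choose.trans (hcov x).choose.symm)
    (𝒢.trans_mem _ (hcov x).choose_spec.1 _ (𝒢.symm_mem _ (hcov x).choose_spec.1)) x
    (Germ.trans_mem_source (φ := (hcov x).choose.symm)
      (Germ.apply_mem_symm_source (hcov x).choose_spec.2) (hcov x).choose_spec.2 rfl)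

theorem unitGerm_eq (hcov : ∀ x : X, ∃ φ ∈ 𝒢.carrier, x ∈ φ.source)
    (φ : OpenPartialHomeomorph X X) (hφ : φ ∈ 𝒢.carrier) (x : X) (hx : x ∈ φ.source)
    (h : φ =ᶠ[𝓝 x] id) : unitGerm hcov x = germ φ hφ x hx := by
  refine Germ.germ_eq_iff.2 ⟨rfl, ?_⟩
  filter_upwards [h, (hcov x).choose.open_source.mem_nhds (hcov x).choose_spec.2] with w hw hw'
  simp [hw, (hcov x).choose.left_inv hw']

theorem exists_unitGerm_eq (hcov : ∀ x : X, ∃ φ ∈ 𝒢.carrier, x ∈ φ.source) (x : X) :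
    ∃ (φ : OpenPartialHomeomorph X X) (hφ : φ ∈ 𝒢.carrier) (hx : x ∈ φ.source),
      φ =ᶠ[𝓝 x] id ∧ unitGerm hcov x = germ φ hφ x hx := by
  refine ⟨_, _, _, ?_, rfl⟩
  filter_upwards [(hcov x).choose.open_source.mem_nhds (hcov x).choose_spec.2] with w hw
  simp [(hcov x).choose.left_inv hw]

/-- The groupoid of germs of a pseudogroup on `X` whose domains cover `X`, so that `X` is its unit
space. -/
noncomputable def germGroupoid (𝒢 : Pseudogroup X)
    (hcov : ∀ x : X, ∃ φ ∈ 𝒢.carrier, x ∈ φ.source) : ArrowGroupoid X 𝒢.Germ where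
  r := Germ.range
  s := Germ.source
  unit := unitGerm hcov
  inv := Germ.inv
  mul := Germ.mul
  r_unit x := by
    obtain ⟨φ, hφ, hx, h, e⟩ := exists_unitGerm_eq hcov x
    rw [e, Germ.range_germ, h.self_of_nhds, id]
  s_unit x := rfl
  r_inv g := by
    obtain ⟨φ, hφ, y, hy, rfl⟩ := g.exists_rep
    exact φ.left_inv hy
  s_inv g := by
    obtain ⟨φ, hφ, y, hy, rfl⟩ := g.exists_rep
    rfl
  r_mul g g' h := by
    obtain ⟨φ, hφ, y, hy, rfl⟩ := g.exists_rep
    obtain ⟨ψ, hψ, z, hz, rfl⟩ := g'.exists_rep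
    rw [Germ.germ_mul_germ φ ψ hφ hψ y z hy hz h]
    have h' : y = ψ z := h
    simp [h']
  s_mul g g' h := by
    obtain ⟨φ, hφ, y, hy, rfl⟩ := g.exists_rep
    obtain ⟨ψ, hψ, z, hz, rfl⟩ := g'.exists_rep
    rw [Germ.germ_mul_germ φ ψ hφ hψ y z hy hz h]
    simp
  mul_assoc g₁ g₂ g₃ h₁₂ h₂₃ := by
    obtain ⟨φ, hφ, x, hx, rfl⟩ := g₁.exists_rep
    obtain ⟨ψ, hψ, y, hy, rfl⟩ := g₂.exists_rep
    obtain ⟨χ, hχ, z, hz, rfl⟩ := g₃.exists_rep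
    have e₁ := Germ.germ_mul_germ φ ψ hφ hψ x y hx hy h₁₂
    have e₂ := Germ.germ_mul_germ ψ χ hψ hχ y z hy hz h₂₃
    simp only [e₁, e₂]
    rw [Germ.germ_mul_germ (ψ.trans φ) χ _ hχ y z _ hz h₂₃,
      Germ.germ_mul_germ φ (χ.trans ψ) hφ _ x z hx _ (by
        have h₁ : x = ψ y := h₁₂
        have h₂ : y = χ z := h₂₃
        simp [h₁, h₂])]
    exact Germ.germ_eq_iff.2 ⟨rfl, EventuallyEq.of_eq (by simp [Function.comp_assoc])⟩
  unit_mul g := by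
    obtain ⟨φ, hφ, y, hy, rfl⟩ := g.exists_rep
    obtain ⟨ψ, hψ, hx, h, e⟩ := exists_unitGerm_eq hcov (φ y)
    simp only [Germ.range_germ, e]
    rw [Germ.germ_mul_germ ψ φ hψ hφ _ y hx hy rfl]
    refine Germ.germ_eq_iff.2 ⟨rfl, ?_⟩
    filter_upwards [(φ.continuousAt hy).eventually h] with w hw
    simpa using hw
  mul_unit g := by
    obtain ⟨φ, hφ, y, hy, rfl⟩ := g.exists_rep
    obtain ⟨ψ, hψ, hx, h, e⟩ := exists_unitGerm_eq hcov y
    simp only [Germ.source_germ, e]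
    rw [Germ.germ_mul_germ φ ψ hφ hψ y y hy hx h.self_of_nhds.symm]
    refine Germ.germ_eq_iff.2 ⟨rfl, ?_⟩
    filter_upwards [h] with w hw
    simp [hw]
  inv_mul g := by
    obtain ⟨φ, hφ, y, hy, rfl⟩ := g.exists_rep
    simp only [Germ.inv_germ, Germ.source_germ]
    rw [Germ.germ_mul_germ φ.symm φ _ hφ (φ y) y _ hy rfl]
    refine (unitGerm_eq hcov _ _ y _ ?_).symm
    filter_upwards [φ.open_source.mem_nhds hy] with w hw
    simp [φ.left_inv hw]
  mul_inv g := by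
    obtain ⟨φ, hφ, y, hy, rfl⟩ := g.exists_rep
    simp only [Germ.inv_germ, Germ.range_germ]
    rw [Germ.germ_mul_germ φ φ.symm hφ _ y (φ y) hy _ (φ.left_inv hy).symm]
    refine (unitGerm_eq hcov _ _ (φ y) _ ?_).symm
    filter_upwards [φ.open_target.mem_nhds (φ.map_source hy)] with w hw
    simp [φ.right_inv hw]

end Pseudogroup

/-! ### Cartan subalgebras -/

section CStar

variable {A : Type*} [NonUnitalCStarAlgebra A]

/-- The normalizer `N(B) = {n : n B n* ⊆ B and n* B n ⊆ B}`. -/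
def cstarNormalizer (B : NonUnitalStarSubalgebra ℂ A) : Set A :=
  {n | ∀ b ∈ B, n * b * star n ∈ B ∧ star n * b * n ∈ B}

/-- `B` is an abelian sub-C*-algebra of `A` which contains an approximate unit of `A`. -/
structure IsNondegenerateAbelian (B : NonUnitalStarSubalgebra ℂ A) : Prop where
  isClosed : IsClosed (B : Set A)
  comm : ∀ x ∈ B, ∀ y ∈ B, x * y = y * x
  exists_approximateUnit : ∃ l : Filter A, l.IsApproximateUnit ∧ (B : Set A) ∈ l

/-- `P` is a conditional expectation of `A` onto `B`: a positive contractive `B`-bimodule map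
which is the identity on `B`. -/
structure IsConditionalExpectation (B : NonUnitalStarSubalgebra ℂ A) (P : A →ₗ[ℂ] B) : Prop where
  apply_coe : ∀ b : B, P b = b
  positive : ∀ a : A, ∃ c : B, P (star a * a) = star c * c
  norm_le : ∀ a : A, ‖P a‖ ≤ ‖a‖
  map_mul_left : ∀ (b : B) (a : A), P (b * a) = b * P a
  map_mul_right : ∀ (a : A) (b : B), P (a * b) = P a * b

/-- `P` is faithful: `P (a* a) = 0` only for `a = 0`. -/
def IsFaithfulExpectation {B : NonUnitalStarSubalgebra ℂ A} (P : A →ₗ[ℂ] B) : Prop :=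
  ∀ a : A, P (star a * a) = 0 → a = 0

/-- `B` is a Cartan subalgebra of `A`, i.e. `(A, B)` is a Cartan pair. -/
structure IsCartanSubalgebra (B : NonUnitalStarSubalgebra ℂ A) : Prop
    extends IsNondegenerateAbelian B where
  maximal : ∀ C : NonUnitalStarSubalgebra ℂ A, IsClosed (C : Set A) →
    (∀ x ∈ C, ∀ y ∈ C, x * y = y * x) → B ≤ C → C = B
  regular : (NonUnitalStarAlgebra.adjoin ℂ (cstarNormalizer B)).topologicalClosure = ⊤
  exists_expectation : ∃ P : A →ₗ[ℂ] B, IsConditionalExpectation B P ∧ IsFaithfulExpectation P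

/-! ### The normalizer and its action on the spectrum -/

/-- The spectrum of `B` (nonzero multiplicative functionals, pointwise convergence). An element `b`
of `B` is identified with the function `x ↦ x b` on it. -/
abbrev GelfandSpectrum (B : NonUnitalStarSubalgebra ℂ A) : Type _ :=
  WeakDual.characterSpace ℂ B

variable {B : NonUnitalStarSubalgebra ℂ A} {m n : A}

theorem star_mem_cstarNormalizer (hn : n ∈ cstarNormalizer B) : star n ∈ cstarNormalizer B :=
  fun b hb => by simpa using (hn b hb).symm

theorem mul_mem_cstarNormalizer (hm : m ∈ cstarNormalizer B) (hn : n ∈ cstarNormalizer B) :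
    m * n ∈ cstarNormalizer B := fun b hb => by
  have h1 := (hm _ (hn b hb).1).1
  have h2 := (hn _ (hm b hb).2).2
  simp only [star_mul, mul_assoc] at h1 h2 ⊢
  exact ⟨h1, h2⟩

theorem mem_cstarNormalizer_of_mem {b : A} (hb : b ∈ B) : b ∈ cstarNormalizer B :=
  fun _ hc => ⟨mul_mem (mul_mem hb hc) (star_mem hb), mul_mem (mul_mem (star_mem hb) hc) hb⟩

/-- `b ↦ n* b n` as a map of `B` into itself. -/
def conjElem (hn : n ∈ cstarNormalizer B) (b : B) : B :=
  ⟨star n * b * n, (hn b b.2).2⟩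

@[simp] theorem coe_conjElem (hn : n ∈ cstarNormalizer B) (b : B) :
    (conjElem hn b : A) = star n * b * n := rfl

namespace IsNondegenerateAbelian

theorem star_mul_self_mem (hB : IsNondegenerateAbelian B) (hn : n ∈ cstarNormalizer B) :
    star n * n ∈ B := by
  obtain ⟨l, hl, hlB⟩ := hB.exists_approximateUnit
  have := hl.neBot
  have h : Tendsto (fun e => star n * (e * n)) l (𝓝 (star n * n)) :=
    (hl.tendsto_mul_right n).const_mul (star n)
  refine hB.isClosed.mem_of_tendsto h ?_
  filter_upwards [hlB] with e he
  have := (hn e he).2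
  rwa [mul_assoc] at this

/-- The element `n* n` of `B`. -/
def sq (hB : IsNondegenerateAbelian B) (hn : n ∈ cstarNormalizer B) : B :=
  ⟨star n * n, hB.star_mul_self_mem hn⟩

@[simp] theorem coe_sq (hB : IsNondegenerateAbelian B) (hn : n ∈ cstarNormalizer B) :
    (hB.sq hn : A) = star n * n := rfl

/-- Characters of `B` are real on self-adjoint elements. -/
theorem conj_apply_of_isSelfAdjoint (hB : IsNondegenerateAbelian B) (y : GelfandSpectrum B)
    {h : B} (hh : IsSelfAdjoint h) : star (y h) = y h := by
  have hc : IsClosed (B : Set A) := hB.isClosed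
  have h1 : y h ∈ quasispectrum ℂ h :=
    NonUnitalAlgHom.quasispectrum_apply_subset y h
      (spectrum_subset_quasispectrum ℂ (y h) (show y h ∈ spectrum ℂ (algebraMap ℂ ℂ (y h)) by
        rw [spectrum.scalar_eq]
        rfl))
  have h2 := hh.quasispectrumRestricts.rightInvOn h1
  rw [← h2]
  simp

theorem apply_star (hB : IsNondegenerateAbelian B) (y : GelfandSpectrum B) (b : B) :
    y (star b) = star (y b) := by
  have h1 := hB.conj_apply_of_isSelfAdjoint y (IsSelfAdjoint.add_star_self b)
  have h2 : IsSelfAdjoint (Complex.I • (b - star b)) := by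
    rw [IsSelfAdjoint, star_smul, star_sub, star_star, Complex.star_def, Complex.conj_I,
      neg_smul, ← smul_neg, neg_sub]
  have h3 := hB.conj_apply_of_isSelfAdjoint y h2
  simp only [map_add, map_sub, map_smul, smul_eq_mul, star_add, star_sub, star_mul',
    Complex.star_def, Complex.conj_I] at h1 h3 ⊢
  have h4 := mul_left_cancel₀ Complex.I_ne_zero
    (show Complex.I * ((starRingEnd ℂ) (y (star b)) - (starRingEnd ℂ) (y b)) =
      Complex.I * (y b - y (star b)) by linear_combination h3)
  linear_combination h4 / 2 - h1 / 2

/-- The function `n* n` on the spectrum of `B` is non-negative. -/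
theorem sq_apply_nonneg (hB : IsNondegenerateAbelian B) (hn : n ∈ cstarNormalizer B)
    (y : GelfandSpectrum B) : 0 ≤ y (hB.sq hn) := by
  let _ : PartialOrder A := CStarAlgebra.spectralOrder A
  have : StarOrderedRing A := CStarAlgebra.spectralOrderedRing A
  have hc : IsClosed (B : Set A) := hB.isClosed
  have hpos : 0 ≤ star n * n := star_mul_self_nonneg n
  have hmem : cfcₙ Real.sqrt (star n * n) ∈ B := cfcₙ_mem (𝕜' := ℂ) _ (hB.star_mul_self_mem hn)
  have hsa : IsSelfAdjoint (cfcₙ Real.sqrt (star n * n)) := cfcₙ_predicate _ _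
  have hsq : cfcₙ Real.sqrt (star n * n) * cfcₙ Real.sqrt (star n * n) = star n * n := by
    rw [← cfcₙ_mul .., cfcₙ_congr (g := id), cfcₙ_id ..]
    intro x hx
    exact Real.mul_self_sqrt (quasispectrum_nonneg_of_nonneg _ hpos x hx)
  set c : B := ⟨_, hmem⟩ with hcdef
  have hc1 : IsSelfAdjoint c := Subtype.ext hsa
  have hc2 : hB.sq hn = star c * c := Subtype.ext (by
    rw [hc1.star_eq]
    exact hsq.symm)
  rw [hc2, map_mul, hB.apply_star]
  exact star_mul_self_nonneg _

/-- `dom n = {y : n* n (y) > 0}`. -/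
def dom (hB : IsNondegenerateAbelian B) (hn : n ∈ cstarNormalizer B) : Set (GelfandSpectrum B) :=
  {y | 0 < y (hB.sq hn)}

theorem mem_dom_iff (hB : IsNondegenerateAbelian B) (hn : n ∈ cstarNormalizer B)
    {y : GelfandSpectrum B} : y ∈ hB.dom hn ↔ y (hB.sq hn) ≠ 0 :=
  ⟨fun h => ne_of_gt h, fun h => lt_of_le_of_ne (hB.sq_apply_nonneg hn y) h.symm⟩

theorem continuous_eval (b : B) : Continuous fun y : GelfandSpectrum B => y b :=
  (WeakDual.eval_continuous b).comp continuous_subtype_val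

theorem isOpen_dom (hB : IsNondegenerateAbelian B) (hn : n ∈ cstarNormalizer B) :
    IsOpen (hB.dom hn) := by
  have : hB.dom hn = {y | y (hB.sq hn) ≠ 0} := Set.ext fun y => hB.mem_dom_iff hn
  rw [this]
  exact isOpen_ne_fun (continuous_eval _) continuous_const

theorem conjElem_mul_conjElem (hB : IsNondegenerateAbelian B) (hn : n ∈ cstarNormalizer B)
    (b c : B) : conjElem hn b * conjElem hn c = conjElem hn (b * c) * hB.sq hn := by
  apply Subtype.ext
  have h1 : n * star n ∈ B := by
    simpa using hB.star_mul_self_mem (star_mem_cstarNormalizer hn)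
  have h2 := hB.comm _ h1 c c.2
  calc star n * b * n * (star n * c * n) = star n * b * ((n * star n) * c) * n := by
        simp only [mul_assoc]
    _ = star n * (b * c) * n * (star n * n) := by
        rw [h2]
        simp only [mul_assoc]

theorem conjElem_sq_star (hB : IsNondegenerateAbelian B) (hn : n ∈ cstarNormalizer B) :
    conjElem hn (hB.sq (star_mem_cstarNormalizer hn)) = hB.sq hn * hB.sq hn :=
  Subtype.ext (by simp [mul_assoc])

theorem conjElem_conjElem_star (hB : IsNondegenerateAbelian B) (hn : n ∈ cstarNormalizer B)
    (b : B) : conjElem hn (conjElem (star_mem_cstarNormalizer hn) b) =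
      hB.sq hn * b * hB.sq hn :=
  Subtype.ext (by simp [mul_assoc])

/-- `b ↦ n* b n` as a continuous linear map of `B` into itself. -/
def conjCLM (hn : n ∈ cstarNormalizer B) : B →L[ℂ] B where
  toFun := conjElem hn
  map_add' b c := Subtype.ext (by simp [mul_add, add_mul])
  map_smul' z b := Subtype.ext (by simp [mul_smul_comm, smul_mul_assoc])
  cont := by
    refine Continuous.subtype_mk ?_ _
    fun_prop

/-- For `y ∈ dom n`, the character `α_n(y)` of `B`, given by
`b (α_n y) = (n* b n) (y) / (n* n) (y)`. -/
noncomputable def weylChar (hB : IsNondegenerateAbelian B) (hn : n ∈ cstarNormalizer B)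
    (y : GelfandSpectrum B) (hy : y ∈ hB.dom hn) : GelfandSpectrum B :=
  ⟨(y (hB.sq hn))⁻¹ • (WeakDual.CharacterSpace.toCLM y ∘L conjCLM hn : B →L[ℂ] ℂ), by
    have h0 := (hB.mem_dom_iff hn).1 hy
    constructor
    · intro h
      have h1 : (y (hB.sq hn))⁻¹ *
          y (conjElem hn (hB.sq (star_mem_cstarNormalizer hn))) = 0 :=
        DFunLike.congr_fun h (hB.sq (star_mem_cstarNormalizer hn))
      rw [hB.conjElem_sq_star, map_mul] at h1
      simp [h0] at h1
    · intro b c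
      change (y (hB.sq hn))⁻¹ * y (conjElem hn (b * c)) =
        ((y (hB.sq hn))⁻¹ * y (conjElem hn b)) * ((y (hB.sq hn))⁻¹ * y (conjElem hn c))
      have h1 := congrArg y (hB.conjElem_mul_conjElem hn b c)
      rw [map_mul, map_mul] at h1
      field_simp
      linear_combination -h1⟩

theorem weylChar_apply (hB : IsNondegenerateAbelian B) (hn : n ∈ cstarNormalizer B)
    (y : GelfandSpectrum B) (hy : y ∈ hB.dom hn) (b : B) :
    hB.weylChar hn y hy b = (y (hB.sq hn))⁻¹ * y (conjElem hn b) := rfl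

/-- The defining relation `(n* b n) (y) = b (α_n y) (n* n) (y)`. -/
theorem weylChar_spec (hB : IsNondegenerateAbelian B) (hn : n ∈ cstarNormalizer B)
    (y : GelfandSpectrum B) (hy : y ∈ hB.dom hn) (b : B) :
    y (conjElem hn b) = hB.weylChar hn y hy b * y (hB.sq hn) := by
  have h0 := (hB.mem_dom_iff hn).1 hy
  rw [weylChar_apply]
  field_simp

theorem weylChar_mem (hB : IsNondegenerateAbelian B) (hn : n ∈ cstarNormalizer B)
    (y : GelfandSpectrum B) (hy : y ∈ hB.dom hn) :
    hB.weylChar hn y hy ∈ hB.dom (star_mem_cstarNormalizer hn) := by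
  have h0 := (hB.mem_dom_iff hn).1 hy
  rw [hB.mem_dom_iff, weylChar_apply, hB.conjElem_sq_star, map_mul]
  simpa using h0

theorem weylChar_star_weylChar (hB : IsNondegenerateAbelian B) (hn : n ∈ cstarNormalizer B)
    (y : GelfandSpectrum B) (hy : y ∈ hB.dom hn) :
    hB.weylChar (star_mem_cstarNormalizer hn) _ (hB.weylChar_mem hn y hy) = y := by
  have h0 := (hB.mem_dom_iff hn).1 hy
  ext b
  rw [weylChar_apply, weylChar_apply, weylChar_apply, hB.conjElem_sq_star,
    hB.conjElem_conjElem_star, map_mul, map_mul, map_mul]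
  field_simp

open Classical in
/-- `α_n` on `dom n`, extended by the identity (an irrelevant convention). -/
noncomputable def weylMap (hB : IsNondegenerateAbelian B) (hn : n ∈ cstarNormalizer B)
    (y : GelfandSpectrum B) : GelfandSpectrum B :=
  if hy : y ∈ hB.dom hn then hB.weylChar hn y hy else y

theorem weylMap_of_mem (hB : IsNondegenerateAbelian B) (hn : n ∈ cstarNormalizer B)
    {y : GelfandSpectrum B} (hy : y ∈ hB.dom hn) : hB.weylMap hn y = hB.weylChar hn y hy :=
  dif_pos hy

theorem continuousOn_weylMap (hB : IsNondegenerateAbelian B) (hn : n ∈ cstarNormalizer B) :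
    ContinuousOn (hB.weylMap hn) (hB.dom hn) := by
  rw [continuousOn_iff_continuous_domRestrict]
  refine continuous_induced_rng.2 (WeakDual.continuous_of_continuous_eval fun b => ?_)
  have h : (fun y : hB.dom hn => (y.1 (hB.sq hn))⁻¹ * y.1 (conjElem hn b)) =
      fun y : hB.dom hn => (hB.weylMap hn y.1) b := by
    funext y
    rw [hB.weylMap_of_mem hn y.2, weylChar_apply]
  have h2 : Continuous fun y : hB.dom hn => (hB.weylMap hn y.1) b := by
    rw [← h]
    exact (((continuous_eval _).comp continuous_subtype_val).inv₀
      fun y => (hB.mem_dom_iff hn).1 y.2).mul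
        ((continuous_eval _).comp continuous_subtype_val)
  exact h2

theorem dom_congr (hB : IsNondegenerateAbelian B) {n' : A} (e : n = n')
    (hn : n ∈ cstarNormalizer B) (hn' : n' ∈ cstarNormalizer B) : hB.dom hn = hB.dom hn' := by
  subst e
  rfl

theorem weylMap_congr (hB : IsNondegenerateAbelian B) {n' : A} (e : n = n')
    (hn : n ∈ cstarNormalizer B) (hn' : n' ∈ cstarNormalizer B) :
    hB.weylMap hn = hB.weylMap hn' := by
  subst e
  rfl

/-- The partial homeomorphism `α_n : dom n → ran n`, where `ran n = {x : n n* (x) > 0}`. -/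
noncomputable def weylHomeo (hB : IsNondegenerateAbelian B) (hn : n ∈ cstarNormalizer B) :
    OpenPartialHomeomorph (GelfandSpectrum B) (GelfandSpectrum B) where
  toFun := hB.weylMap hn
  invFun := hB.weylMap (star_mem_cstarNormalizer hn)
  source := hB.dom hn
  target := hB.dom (star_mem_cstarNormalizer hn)
  map_source' y hy := by
    rw [hB.weylMap_of_mem hn hy]
    exact hB.weylChar_mem hn y hy
  map_target' y hy := by
    rw [hB.weylMap_of_mem _ hy]
    rw [← hB.dom_congr (star_star n) (star_mem_cstarNormalizer (star_mem_cstarNormalizer hn)) hn]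
    exact hB.weylChar_mem (star_mem_cstarNormalizer hn) y hy
  left_inv' y hy := by
    rw [hB.weylMap_of_mem hn hy, hB.weylMap_of_mem _ (hB.weylChar_mem hn y hy),
      hB.weylChar_star_weylChar]
  right_inv' y hy := by
    have h1 := hB.weylChar_mem (star_mem_cstarNormalizer hn) y hy
    have h2 := hB.weylChar_star_weylChar (star_mem_cstarNormalizer hn) y hy
    rw [hB.weylMap_of_mem _ hy, ← hB.weylMap_congr (star_star n)
      (star_mem_cstarNormalizer (star_mem_cstarNormalizer hn)) hn, hB.weylMap_of_mem _ h1, h2]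
  open_source := hB.isOpen_dom hn
  open_target := hB.isOpen_dom _
  continuousOn_toFun := hB.continuousOn_weylMap hn
  continuousOn_invFun := hB.continuousOn_weylMap _

/-- `(mn)* c (mn) = n* (m* c m) n`. -/
theorem conjElem_mul (hm : m ∈ cstarNormalizer B) (hn : n ∈ cstarNormalizer B) (c : B) :
    conjElem (mul_mem_cstarNormalizer hm hn) c = conjElem hn (conjElem hm c) :=
  Subtype.ext (by simp [mul_assoc])

theorem sq_mul (hB : IsNondegenerateAbelian B) (hm : m ∈ cstarNormalizer B)
    (hn : n ∈ cstarNormalizer B) :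
    hB.sq (mul_mem_cstarNormalizer hm hn) = conjElem hn (hB.sq hm) :=
  Subtype.ext (by simp [mul_assoc])

theorem dom_mul (hB : IsNondegenerateAbelian B) (hm : m ∈ cstarNormalizer B)
    (hn : n ∈ cstarNormalizer B) :
    hB.dom (mul_mem_cstarNormalizer hm hn) = hB.dom hn ∩ hB.weylMap hn ⁻¹' hB.dom hm := by
  ext y
  rw [Set.mem_inter_iff, Set.mem_preimage, hB.mem_dom_iff, hB.sq_mul hm hn]
  by_cases hy : y ∈ hB.dom hn
  · rw [hB.weylMap_of_mem hn hy, hB.mem_dom_iff hm, hB.weylChar_spec hn y hy]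
    simp [hy, (hB.mem_dom_iff hn).1 hy]
  · have h0 : y (hB.sq hn) = 0 := by
      by_contra h
      exact hy ((hB.mem_dom_iff hn).2 h)
    have h1 := congrArg y (hB.conjElem_mul_conjElem hn (hB.sq hm) (hB.sq hm))
    rw [map_mul, map_mul, h0, mul_zero] at h1
    simp [hy, mul_self_eq_zero.1 h1]

theorem weylHomeo_mul (hB : IsNondegenerateAbelian B) (hm : m ∈ cstarNormalizer B)
    (hn : n ∈ cstarNormalizer B) :
    hB.weylHomeo (mul_mem_cstarNormalizer hm hn) ≈ (hB.weylHomeo hn).trans (hB.weylHomeo hm) := by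
  refine ⟨hB.dom_mul hm hn, ?_⟩
  intro y hy
  have hy' : y ∈ hB.dom (mul_mem_cstarNormalizer hm hn) := hy
  have hy2 := hy'
  rw [hB.dom_mul hm hn] at hy2
  obtain ⟨h1, h2⟩ := hy2
  have h3 : hB.weylChar hn y h1 ∈ hB.dom hm := by
    rw [Set.mem_preimage, hB.weylMap_of_mem hn h1] at h2
    exact h2
  change hB.weylMap _ y = hB.weylMap hm (hB.weylMap hn y)
  rw [hB.weylMap_of_mem _ hy', hB.weylMap_of_mem hn h1, hB.weylMap_of_mem hm h3]
  have e1 := (hB.mem_dom_iff hn).1 h1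
  have e3 := (hB.mem_dom_iff hm).1 h3
  rw [weylChar_apply] at e3
  ext c
  simp only [weylChar_apply, conjElem_mul hm hn, hB.sq_mul hm hn]
  field_simp

/-- The Weyl pseudogroup `{α_n : n ∈ N(B)}`. -/
noncomputable def weylPseudogroup (hB : IsNondegenerateAbelian B) :
    Pseudogroup (GelfandSpectrum B) where
  carrier := {φ | ∃ (n : A) (hn : n ∈ cstarNormalizer B), hB.weylHomeo hn ≈ φ}
  symm_mem := by
    rintro φ ⟨n, hn, h⟩
    refine ⟨star n, star_mem_cstarNormalizer hn, Setoid.trans ?_ h.symm'⟩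
    exact ⟨rfl, fun _ _ => rfl⟩
  trans_mem := by
    rintro φ ⟨n, hn, h⟩ ψ ⟨m, hm, h'⟩
    exact ⟨m * n, mul_mem_cstarNormalizer hm hn,
      Setoid.trans (hB.weylHomeo_mul hm hn) (h.trans' h')⟩
  eqOnSource_mem := by
    rintro φ ⟨n, hn, h⟩ ψ h'
    exact ⟨n, hn, Setoid.trans h h'⟩

theorem weylHomeo_mem (hB : IsNondegenerateAbelian B) (hn : n ∈ cstarNormalizer B) :
    hB.weylHomeo hn ∈ hB.weylPseudogroup.carrier := ⟨n, hn, Setoid.refl _⟩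

theorem weylPseudogroup_covers (hB : IsNondegenerateAbelian B) (y : GelfandSpectrum B) :
    ∃ φ ∈ hB.weylPseudogroup.carrier, y ∈ φ.source := by
  obtain ⟨b, hb⟩ : ∃ b : B, y b ≠ 0 := by
    by_contra! h
    exact y.2.1 (ContinuousLinearMap.ext h)
  have hn := mem_cstarNormalizer_of_mem b.2
  refine ⟨hB.weylHomeo hn, hB.weylHomeo_mem hn, (hB.mem_dom_iff hn).2 ?_⟩
  have h : hB.sq hn = star b * b := rfl
  rw [h, map_mul, hB.apply_star]
  simpa using hb

/-- The set of arrows of the Weyl groupoid `G(B)`, with the topology of germs. -/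
abbrev WeylGerm (hB : IsNondegenerateAbelian B) : Type _ := hB.weylPseudogroup.Germ

/-- The Weyl groupoid `G(B)`: the groupoid of germs of the Weyl pseudogroup. -/
noncomputable def weylGroupoid (hB : IsNondegenerateAbelian B) :
    ArrowGroupoid (GelfandSpectrum B) hB.WeylGerm :=
  hB.weylPseudogroup.germGroupoid hB.weylPseudogroup_covers

/-! ### The Weyl twist and the evaluation map -/

/-- The set `D` of triples `(x, n, y)` with `n ∈ N(B)`, `n* n (y) > 0` and `x = α_n(y)`. -/
structure WeylTriple (hB : IsNondegenerateAbelian B) where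
  x : GelfandSpectrum B
  n : A
  mem : n ∈ cstarNormalizer B
  y : GelfandSpectrum B
  y_mem : y ∈ hB.dom mem
  x_eq : x = hB.weylHomeo mem y

/-- `(x, n, y) ∼ (x', n', y')` iff `y = y'` and `n b = n' b'` for some `b, b' ∈ B` with
`b(y), b'(y) > 0`. -/
instance weylTripleSetoid (hB : IsNondegenerateAbelian B) : Setoid hB.WeylTriple where
  r σ τ := σ.y = τ.y ∧ ∃ b b' : B, 0 < σ.y b ∧ 0 < σ.y b' ∧ σ.n * b = τ.n * b'
  iseqv :=
    { refl := fun σ => ⟨rfl, hB.sq σ.mem, hB.sq σ.mem, σ.y_mem, σ.y_mem, rfl⟩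
      symm := fun {_ _} ⟨h, b, b', hb, hb', e⟩ => ⟨h.symm, b', b, h ▸ hb', h ▸ hb, e.symm⟩
      trans := by
        rintro σ τ υ ⟨h, b, b', hb, hb', e⟩ ⟨h', c, c', hc, hc', e'⟩
        rw [← h] at hc hc'
        refine ⟨h.trans h', b * c, c' * b', ?_, ?_, ?_⟩
        · rw [map_mul]
          exact mul_pos hb hc
        · rw [map_mul]
          exact mul_pos hc' hb'
        · calc σ.n * ((b : A) * c) = τ.n * (b' * c) := by
                rw [← mul_assoc, e, mul_assoc]
            _ = τ.n * (c * b') := by rw [hB.comm _ b'.2 _ c.2]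
            _ = υ.n * (c' * b') := by rw [← mul_assoc, e', mul_assoc] }

/-- The Weyl twist `Σ(B)`, as a set. -/
def WeylTwist (hB : IsNondegenerateAbelian B) : Type _ := Quotient hB.weylTripleSetoid

/-- For `b ∈ B`, `b* (n* c n) b` has the value `|b(y)|² (n* c n)(y)` at `y`. -/
theorem apply_conjElem_of_mul_eq (hB : IsNondegenerateAbelian B) {n' : A}
    (hn : n ∈ cstarNormalizer B) (hn' : n' ∈ cstarNormalizer B) (b b' c : B)
    (e : n * b = n' * b') (y : GelfandSpectrum B) :
    star (y b) * y b * y (conjElem hn c) = star (y b') * y b' * y (conjElem hn' c) := by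
  have h : star b * conjElem hn c * b = star b' * conjElem hn' c * b' := by
    apply Subtype.ext
    calc star (b : A) * (star n * c * n) * b = star (n * (b : A)) * c * (n * b) := by
          simp only [star_mul, mul_assoc]
      _ = star (b' : A) * (star n' * c * n') * b' := by
          rw [e]
          simp only [star_mul, mul_assoc]
  have h' := congrArg y h
  simp only [map_mul, hB.apply_star] at h'
  linear_combination h'

theorem apply_sq_of_mul_eq (hB : IsNondegenerateAbelian B) {n' : A}
    (hn : n ∈ cstarNormalizer B) (hn' : n' ∈ cstarNormalizer B) (b b' : B)
    (e : n * b = n' * b') (y : GelfandSpectrum B) :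
    star (y b) * y b * y (hB.sq hn) = star (y b') * y b' * y (hB.sq hn') := by
  have h : star b * hB.sq hn * b = star b' * hB.sq hn' * b' := by
    apply Subtype.ext
    calc star (b : A) * (star n * n) * b = star (n * (b : A)) * (n * b) := by
          simp only [star_mul, mul_assoc]
      _ = star (b' : A) * (star n' * n') * b' := by
          rw [e]
          simp only [star_mul, mul_assoc]
  have h' := congrArg y h
  simp only [map_mul, hB.apply_star] at h'
  linear_combination h'

/-- The map `[x, n, y] ↦ [x, α_n, y]` from `Σ(B)` to `G(B)`. -/
noncomputable def WeylTwist.toGerm {hB : IsNondegenerateAbelian B} : hB.WeylTwist → hB.WeylGerm :=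
  Quotient.lift
    (fun σ => Pseudogroup.germ (hB.weylHomeo σ.mem) (hB.weylHomeo_mem σ.mem) σ.y σ.y_mem) (by
      rintro σ τ ⟨h, b, b', hb, hb', e⟩
      refine Pseudogroup.Germ.germ_eq_iff.2 ⟨h, ?_⟩
      have h1 : ∀ᶠ z in 𝓝 σ.y, z b ≠ 0 :=
        (continuous_eval b).continuousAt.eventually_ne (ne_of_gt hb)
      have h2 : ∀ᶠ z in 𝓝 σ.y, z b' ≠ 0 :=
        (continuous_eval b').continuousAt.eventually_ne (ne_of_gt hb')
      filter_upwards [h1, h2, (hB.isOpen_dom σ.mem).mem_nhds σ.y_mem,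
        (hB.isOpen_dom τ.mem).mem_nhds (h ▸ τ.y_mem)] with z z1 z2 z3 z4
      change hB.weylMap _ z = hB.weylMap _ z
      rw [hB.weylMap_of_mem _ z3, hB.weylMap_of_mem _ z4]
      ext c
      have k1 := hB.apply_conjElem_of_mul_eq σ.mem τ.mem b b' c e z
      have k2 := hB.apply_sq_of_mul_eq σ.mem τ.mem b b' e z
      have k3 := (hB.mem_dom_iff _).1 z3
      have k4 := (hB.mem_dom_iff _).1 z4
      have k5 : star (z b) * z b ≠ 0 := mul_ne_zero (star_ne_zero.2 z1) z1
      rw [weylChar_apply, weylChar_apply, inv_mul_eq_div, inv_mul_eq_div, div_eq_div_iff k3 k4]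
      refine mul_left_cancel₀ k5 (mul_left_cancel₀
        (mul_ne_zero (star_ne_zero.2 z2) z2) ?_)
      linear_combination (star (z b') * z b' * z (hB.sq τ.mem)) * k1 -
        (star (z b') * z b' * z (conjElem τ.mem c)) * k2)

/-- The evaluation of `a ∈ A` on a triple: `â(x, n, y) = P(n* a)(y) / √(n* n (y))`. -/
noncomputable def WeylTriple.eval {hB : IsNondegenerateAbelian B} (P : A →ₗ[ℂ] B) (a : A)
    (σ : hB.WeylTriple) : ℂ :=
  σ.y (P (star σ.n * a)) / (Real.sqrt (σ.y (hB.sq σ.mem)).re : ℝ)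

/-- The evaluation `â` as a function on `Σ(B)`, i.e. as a section of the line bundle associated
with `Σ(B)`. -/
noncomputable def WeylTwist.eval {hB : IsNondegenerateAbelian B} {P : A →ₗ[ℂ] B}
    (hP : IsConditionalExpectation B P) (a : A) : hB.WeylTwist → ℂ :=
  Quotient.lift (fun σ => σ.eval P a) (by
    rintro σ τ ⟨h, b, b', hb, hb', e⟩
    have h1 : star b * P (star σ.n * a) = star b' * P (star τ.n * a) := by
      rw [← hP.map_mul_left, ← hP.map_mul_left]
      congr 1
      calc star (b : A) * (star σ.n * a) = star (σ.n * (b : A)) * a := by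
            rw [star_mul, mul_assoc]
        _ = star (b' : A) * (star τ.n * a) := by rw [e, star_mul, mul_assoc]
    have h1' := congrArg σ.y h1
    have h2 := hB.apply_sq_of_mul_eq σ.mem τ.mem b b' e σ.y
    rw [map_mul σ.y, map_mul σ.y, hB.apply_star, hB.apply_star] at h1'
    have hτ := τ.y_mem
    have hσ := σ.y_mem
    simp only [WeylTriple.eval, dom, Set.mem_ofPred_eq, ← h] at *
    rw [Complex.pos_iff] at hb hb' hτ hσ
    obtain ⟨r, hr⟩ : ∃ r : ℝ, σ.y b = r := ⟨_, (Complex.ext rfl (by simpa using hb.2.symm))⟩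
    obtain ⟨r', hr'⟩ : ∃ r : ℝ, σ.y b' = r := ⟨_, (Complex.ext rfl (by simpa using hb'.2.symm))⟩
    obtain ⟨s, hs⟩ : ∃ s : ℝ, σ.y (hB.sq σ.mem) = s :=
      ⟨_, (Complex.ext rfl (by simpa using hσ.2.symm))⟩
    obtain ⟨s', hs'⟩ : ∃ s : ℝ, σ.y (hB.sq τ.mem) = s :=
      ⟨_, (Complex.ext rfl (by simpa using hτ.2.symm))⟩
    rw [hr, hr'] at h1' h2
    rw [hs, hs'] at h2
    rw [hr] at hb
    rw [hr'] at hb'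
    rw [hs] at hσ ⊢
    rw [hs'] at hτ ⊢
    simp only [Complex.ofReal_re, Complex.star_def, Complex.conj_ofReal] at *
    have h3 : r * Real.sqrt s = r' * Real.sqrt s' := by
      have h2' : r * r * s = r' * r' * s' := by exact_mod_cast h2
      rw [← Real.sqrt_mul_self hb.1.le, ← Real.sqrt_mul_self hb'.1.le,
        ← Real.sqrt_mul (mul_self_nonneg r), ← Real.sqrt_mul (mul_self_nonneg r'), h2']
    have h3' : (r : ℂ) * (Real.sqrt s : ℝ) = r' * (Real.sqrt s' : ℝ) := by exact_mod_cast h3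
    have n1 : ((Real.sqrt s : ℝ) : ℂ) ≠ 0 := by
      exact_mod_cast (Real.sqrt_pos.2 hσ.1).ne'
    have n2 : ((Real.sqrt s' : ℝ) : ℂ) ≠ 0 := by
      exact_mod_cast (Real.sqrt_pos.2 hτ.1).ne'
    have n3 : (r : ℂ) ≠ 0 := by exact_mod_cast hb.1.ne'
    rw [div_eq_div_iff n1 n2]
    have n4 : (r' : ℂ) ≠ 0 := by exact_mod_cast hb'.1.ne'
    refine mul_left_cancel₀ n3 (mul_left_cancel₀ n4 ?_)
    linear_combination (r' * (Real.sqrt s' : ℝ) : ℂ) * h1' -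
      (r' * σ.y (P (star τ.n * a)) : ℂ) * h3')

end IsNondegenerateAbelian

end CStar

/-! Étaleness has nothing to do with C*-algebras. In any groupoid of germs, agreement of two germs
persists to nearby points, so `y ↦ [φ y, φ, y]` is a continuous section inverting the source map on
an open set (`continuous_germ`). Hence the source is a local homeomorphism, inversion transfers this
to the range, and the remaining structure maps are continuous because locally they are such
sections.

The Hausdorff property and the separation of points rest on a conditional expectation `P`, through
two facts about a normalizer `n` viewed on the spectrum. First, if `P(n)(y) ≠ 0`, then `y` lies in
the domain of `α_n` and is fixed by it (`mem_dom`, `weylMap_eq_self`). Applied to `m* n`, whose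
partial homeomorphism is `α_m⁻¹ α_n`, this shows that `α_n` and `α_m` have the same germ wherever
`P(m* n)` does not vanish (`weylMap_eventuallyEq`). Second, at an interior fixed point of `α_n` one
has `|P(n)|² = n* n`: cutting `n` down by a function supported near the point gives an element
commuting with `B`, hence in `B` by maximality, and `P` does not move it
(`star_mul_self_apply_eq_of_eventually_fixed`).

Now let `[x, α_n, y]` and `[x, α_m, y]` be different germs and put `k = m* n`. Then `P(k)(y) = 0`
while `k* k (y) > 0`, so `|P(k)|² ≠ k* k` near `y`. By the second fact the germs of `α_n` and `α_m`
differ at all nearby points, which yields disjoint neighbourhoods. For the evaluated sections, `a =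
n b` with `b ∈ B` works: its value at the class of `(x', m, y')` is a multiple of `P(m* n)(y')
b(y')`, which vanishes by the first fact when `y = y'`, and by the choice of `b` otherwise. -/

namespace Pseudogroup

variable {X : Type*} [TopologicalSpace X] {𝒢 : Pseudogroup X}

/-! ### The topology of germs and the structure maps -/

namespace Germ

theorem isOpen_basicOpen {U V : Set X} (hU : IsOpen U) (φ : OpenPartialHomeomorph X X)
    (hφ : φ ∈ 𝒢.carrier) (hV : IsOpen V) : IsOpen (basicOpen U φ hφ V : Set 𝒢.Germ) :=
  TopologicalSpace.isOpen_generateFrom_of_mem ⟨U, V, φ, hφ, hU, hV, rfl⟩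

theorem germ_mem_basicOpen {φ : OpenPartialHomeomorph X X} {hφ : φ ∈ 𝒢.carrier} {y : X}
    {hy : y ∈ φ.source} {U V : Set X} (h₁ : φ y ∈ U) (h₂ : y ∈ V) :
    germ φ hφ y hy ∈ basicOpen U φ hφ V := ⟨y, hy, rfl, h₁, h₂⟩

theorem germ_mem_basicOpen_iff {φ ψ : OpenPartialHomeomorph X X} {hφ : φ ∈ 𝒢.carrier}
    {hψ : ψ ∈ 𝒢.carrier} {y : X} {hy : y ∈ φ.source} {U V : Set X} :
    germ φ hφ y hy ∈ basicOpen U ψ hψ V ↔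
      y ∈ ψ.source ∧ φ =ᶠ[𝓝 y] ψ ∧ ψ y ∈ U ∧ y ∈ V := by
  constructor
  · rintro ⟨z, hz, e, h₁, h₂⟩
    obtain ⟨rfl, h⟩ := germ_eq_iff.1 e
    exact ⟨hz, h, h₁, h₂⟩
  · rintro ⟨hz, h, h₁, h₂⟩
    exact ⟨y, hz, germ_eq_iff.2 ⟨rfl, h⟩, h₁, h₂⟩

theorem continuous_source : Continuous (source : 𝒢.Germ → X) := by
  refine continuous_def.2 fun V hV => isOpen_iff_forall_mem_open.2 fun g hg => ?_
  obtain ⟨φ, hφ, y, hy, rfl⟩ := g.exists_rep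
  refine ⟨basicOpen Set.univ φ hφ V, ?_, isOpen_basicOpen isOpen_univ φ hφ hV,
    germ_mem_basicOpen trivial hg⟩
  rintro _ ⟨z, hz, rfl, -, h⟩
  exact h

theorem continuous_range : Continuous (range : 𝒢.Germ → X) := by
  refine continuous_def.2 fun U hU => isOpen_iff_forall_mem_open.2 fun g hg => ?_
  obtain ⟨φ, hφ, y, hy, rfl⟩ := g.exists_rep
  refine ⟨basicOpen U φ hφ Set.univ, ?_, isOpen_basicOpen hU φ hφ isOpen_univ,
    germ_mem_basicOpen hg trivial⟩
  rintro _ ⟨z, hz, rfl, h, -⟩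
  exact h

theorem inv_inv (g : 𝒢.Germ) : g.inv.inv = g := by
  obtain ⟨φ, hφ, y, hy, rfl⟩ := g.exists_rep
  exact germ_eq_iff.2 ⟨φ.left_inv hy, EventuallyEq.rfl⟩

theorem source_inv (g : 𝒢.Germ) : g.inv.source = g.range := by
  obtain ⟨φ, hφ, y, hy, rfl⟩ := g.exists_rep
  rfl

theorem inv_mem_basicOpen {g : 𝒢.Germ} {U V : Set X} {φ : OpenPartialHomeomorph X X}
    {hφ : φ ∈ 𝒢.carrier} (h : g ∈ basicOpen U φ hφ V) :
    g.inv ∈ basicOpen V φ.symm (𝒢.symm_mem _ hφ) U := by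
  obtain ⟨y, hy, rfl, h₁, h₂⟩ := h
  exact ⟨φ y, apply_mem_symm_source hy, rfl, by rwa [φ.left_inv hy], h₁⟩

theorem continuous_inv : Continuous (inv : 𝒢.Germ → 𝒢.Germ) := by
  refine continuous_generateFrom_iff.2 ?_
  rintro _ ⟨U, V, φ, hφ, hU, hV, rfl⟩
  have h : (inv : 𝒢.Germ → 𝒢.Germ) ⁻¹' basicOpen U φ hφ V =
      basicOpen V φ.symm (𝒢.symm_mem _ hφ) U := by
    refine Set.Subset.antisymm (fun g hg => ?_) fun g hg => inv_mem_basicOpen hg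
    rw [← g.inv_inv]
    exact inv_mem_basicOpen hg
  rw [h]
  exact isOpen_basicOpen hV _ _ hU

/-- Inversion of germs as a homeomorphism. -/
def invHomeomorph (𝒢 : Pseudogroup X) : 𝒢.Germ ≃ₜ 𝒢.Germ where
  toFun := inv
  invFun := inv
  left_inv := inv_inv
  right_inv := inv_inv
  continuous_toFun := continuous_inv
  continuous_invFun := continuous_inv

/-- Two maps with the same germ at a point have the same germ at all nearby points, so the preimage
of a basic open set is open. All the other continuity statements about germs with a moving base
point reduce to this one. -/
theorem continuous_germ (φ : OpenPartialHomeomorph X X) (hφ : φ ∈ 𝒢.carrier) :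
    Continuous fun y : φ.source => germ φ hφ y y.2 := by
  refine continuous_generateFrom_iff.2 ?_
  rintro _ ⟨U, V, ψ, hψ, hU, hV, rfl⟩
  refine isOpen_iff_mem_nhds.2 ?_
  rintro ⟨y, hy⟩ h
  obtain ⟨h₁, h₂, h₃, h₄⟩ := germ_mem_basicOpen_iff.1 h
  have hev : ∀ᶠ z in 𝓝 y, z ∈ ψ.source ∧ φ =ᶠ[𝓝 z] ψ ∧ ψ z ∈ U ∧ z ∈ V := by
    filter_upwards [ψ.open_source.mem_nhds h₁, h₂.eventually_nhds,
      (ψ.continuousAt h₁).preimage_mem_nhds (hU.mem_nhds h₃), hV.mem_nhds h₄]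
      with z z₁ z₂ z₃ z₄ using ⟨z₁, z₂, z₃, z₄⟩
  filter_upwards [continuous_subtype_val.continuousAt.eventually hev] with z hz
  exact germ_mem_basicOpen_iff.2 hz

open Classical in
/-- The source map, restricted to the germs of `φ`, as a homeomorphism onto the domain
of `φ`. -/
noncomputable def sourceHomeomorph (g : 𝒢.Germ) (φ : OpenPartialHomeomorph X X)
    (hφ : φ ∈ 𝒢.carrier) : OpenPartialHomeomorph 𝒢.Germ X where
  toFun := source
  invFun y := if hy : y ∈ φ.source then germ φ hφ y hy else g
  source := basicOpen Set.univ φ hφ Set.univ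
  target := φ.source
  map_source' := by
    rintro _ ⟨y, hy, rfl, -, -⟩
    exact hy
  map_target' y hy := by
    rw [dif_pos hy]
    exact germ_mem_basicOpen trivial trivial
  left_inv' := by
    rintro _ ⟨y, hy, rfl, -, -⟩
    exact dif_pos hy
  right_inv' y hy := by
    rw [dif_pos hy]
    rfl
  open_source := isOpen_basicOpen isOpen_univ φ hφ isOpen_univ
  open_target := φ.open_source
  continuousOn_toFun := continuous_source.continuousOn
  continuousOn_invFun := by
    rw [continuousOn_iff_continuous_domRestrict]
    refine (continuous_germ φ hφ).congr fun y => ?_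
    simp [y.2]

theorem isLocalHomeomorph_source : IsLocalHomeomorph (source : 𝒢.Germ → X) := by
  intro g
  obtain ⟨φ, hφ, y, hy, rfl⟩ := g.exists_rep
  exact ⟨sourceHomeomorph (germ φ hφ y hy) φ hφ, germ_mem_basicOpen trivial trivial, rfl⟩

theorem isLocalHomeomorph_range : IsLocalHomeomorph (range : 𝒢.Germ → X) := by
  have h : (range : 𝒢.Germ → X) = source ∘ invHomeomorph 𝒢 :=
    funext fun g => (source_inv g).symm
  rw [h]
  exact isLocalHomeomorph_source.comp (invHomeomorph 𝒢).isLocalHomeomorph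

/-- Near a composable pair of germs of `φ` and `ψ`, every composable pair again consists of germs of
`φ` and `ψ`. There the product is the germ of the one map `φ ψ` at the source of the second factor,
hence continuous. -/
theorem continuous_mul : Continuous fun p : {p : 𝒢.Germ × 𝒢.Germ // p.1.source = p.2.range} =>
    mul p.1.1 p.1.2 p.2 := by
  refine continuous_iff_continuousAt.2 ?_
  rintro ⟨⟨g, g'⟩, h⟩
  obtain ⟨φ, hφ, y, hy, rfl⟩ := g.exists_rep
  obtain ⟨ψ, hψ, z, hz, rfl⟩ := g'.exists_rep
  let S : Set {p : 𝒢.Germ × 𝒢.Germ // p.1.source = p.2.range} :=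
    {p | p.1.1 ∈ basicOpen Set.univ φ hφ Set.univ ∧ p.1.2 ∈ basicOpen Set.univ ψ hψ Set.univ}
  have hS : IsOpen S :=
    ((isOpen_basicOpen isOpen_univ φ hφ isOpen_univ).preimage
      (continuous_fst.comp continuous_subtype_val)).inter
    ((isOpen_basicOpen isOpen_univ ψ hψ isOpen_univ).preimage
      (continuous_snd.comp continuous_subtype_val))
  have hrep : ∀ p ∈ S, ∃ (u : X) (hu : u ∈ φ.source) (v : X) (hv : v ∈ ψ.source),
      p.1 = (germ φ hφ u hu, germ ψ hψ v hv) := by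
    rintro p ⟨⟨u, hu, e, -, -⟩, ⟨v, hv, e', -, -⟩⟩
    exact ⟨u, hu, v, hv, Prod.ext e e'⟩
  have hmem : ∀ p : S, p.1.1.2.source ∈ (ψ.trans φ).source := by
    rintro ⟨⟨p, h'⟩, hp⟩
    obtain ⟨u, hu, v, hv, e⟩ := hrep _ hp
    obtain rfl : p = _ := e
    exact trans_mem_source hu hv h'
  have hc : Continuous fun p : S =>
      germ (ψ.trans φ) (𝒢.trans_mem _ hψ _ hφ) p.1.1.2.source (hmem p) :=
    (continuous_germ (ψ.trans φ) (𝒢.trans_mem _ hψ _ hφ)).comp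
      (f := fun p : S => (⟨p.1.1.2.source, hmem p⟩ : (ψ.trans φ).source))
      (Continuous.subtype_mk (continuous_source.comp (continuous_snd.comp
        (continuous_subtype_val.comp continuous_subtype_val))) _)
  have hcS : ContinuousOn (fun p : {p : 𝒢.Germ × 𝒢.Germ // p.1.source = p.2.range} =>
      mul p.1.1 p.1.2 p.2) S := by
    rw [continuousOn_iff_continuous_domRestrict]
    refine hc.congr ?_
    rintro ⟨⟨p, h'⟩, hp⟩
    obtain ⟨u, hu, v, hv, e⟩ := hrep _ hp
    obtain rfl : p = _ := e
    exact (germ_mul_germ φ ψ hφ hψ u v hu hv h').symm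
  exact hcS.continuousAt (hS.mem_nhds
    ⟨germ_mem_basicOpen trivial trivial, germ_mem_basicOpen trivial trivial⟩)

end Germ

/-! ### Étaleness and a Hausdorff criterion for germ groupoids -/

theorem continuous_unitGerm (hcov : ∀ x : X, ∃ φ ∈ 𝒢.carrier, x ∈ φ.source) :
    Continuous (unitGerm hcov) := by
  refine continuous_iff_continuousAt.2 fun x => ?_
  obtain ⟨φ, hφ, hx, h, -⟩ := exists_unitGerm_eq hcov x
  obtain ⟨V, hV, hVo, hxV⟩ := eventually_nhds_iff.1 h
  -- The representative of a unit is chosen separately at each point, but on the open set where `φ`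
  -- is the identity all these choices give the germ of the single map `φ`.
  have hc : ContinuousOn (unitGerm hcov) (V ∩ φ.source) := by
    rw [continuousOn_iff_continuous_domRestrict]
    refine ((Germ.continuous_germ φ hφ).comp
      (continuous_inclusion (Set.inter_subset_right (s := V)))).congr fun y => ?_
    exact (unitGerm_eq hcov φ hφ y y.2.2
      (eventually_nhds_iff.2 ⟨V, hV, hVo, y.2.1⟩)).symm
  exact hc.continuousAt ((hVo.inter φ.open_source).mem_nhds ⟨hxV, hx⟩)

/-- The groupoid of germs of a pseudogroup is étale. -/
theorem isEtale_germGroupoid (hcov : ∀ x : X, ∃ φ ∈ 𝒢.carrier, x ∈ φ.source) :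
    (𝒢.germGroupoid hcov).IsEtale where
  continuous_r := Germ.continuous_range
  continuous_s := Germ.continuous_source
  isEmbedding_unit := Function.LeftInverse.isEmbedding (f := Germ.source) (fun _ => rfl)
    Germ.continuous_source (continuous_unitGerm hcov)
  continuous_inv := Germ.continuous_inv
  continuous_mul := Germ.continuous_mul
  surjective_r x := ⟨unitGerm hcov x, (𝒢.germGroupoid hcov).r_unit x⟩
  surjective_s x := ⟨unitGerm hcov x, rfl⟩
  isOpenMap_r := Germ.isLocalHomeomorph_range.isOpenMap
  isOpenMap_s := Germ.isLocalHomeomorph_source.isOpenMap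
  isLocalHomeomorph_r := Germ.isLocalHomeomorph_range
  isLocalHomeomorph_s := Germ.isLocalHomeomorph_source

/-- Germs over the same point are separated if their representatives have different germs at all
points near it. -/
theorem Germ.t2Space_of_eventually [T2Space X]
    (H : ∀ φ ∈ 𝒢.carrier, ∀ ψ ∈ 𝒢.carrier, ∀ y ∈ φ.source, y ∈ ψ.source → φ y = ψ y →
      ¬ φ =ᶠ[𝓝 y] ψ → ∀ᶠ z in 𝓝 y, z ∈ φ.source → z ∈ ψ.source → ¬ φ =ᶠ[𝓝 z] ψ) :
    T2Space 𝒢.Germ := by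
  refine ⟨fun g g' hne => ?_⟩
  by_cases hs : g.source = g'.source
  swap
  · exact separated_by_continuous continuous_source hs
  by_cases hr : g.range = g'.range
  swap
  · exact separated_by_continuous continuous_range hr
  obtain ⟨φ, hφ, y, hy, rfl⟩ := g.exists_rep
  obtain ⟨ψ, hψ, z, hz, rfl⟩ := g'.exists_rep
  obtain rfl : y = z := hs
  obtain ⟨V, hV, hVo, hyV⟩ := eventually_nhds_iff.1
    (H φ hφ ψ hψ y hy hz hr fun h => hne (germ_eq_iff.2 ⟨rfl, h⟩))
  refine ⟨basicOpen Set.univ φ hφ V, basicOpen Set.univ ψ hψ V,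
    isOpen_basicOpen isOpen_univ φ hφ hVo, isOpen_basicOpen isOpen_univ ψ hψ hVo,
    germ_mem_basicOpen trivial hyV, germ_mem_basicOpen trivial hyV, ?_⟩
  refine Set.disjoint_left.2 ?_
  rintro _ ⟨w, hw, rfl, -, hwV⟩ h
  obtain ⟨h₁, h₂, -, -⟩ := germ_mem_basicOpen_iff.1 h
  exact hV w hwV hw h₁ h₂

end Pseudogroup

/-! ### Elements of `B` as functions on the spectrum -/

/-- The characters of a commutative C*-algebra separate its points from zero. -/
theorem NonUnitalCommCStarAlgebra.eq_zero_of_forall_character {D : Type*}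
    [NonUnitalCommCStarAlgebra D] (b : D)
    (h : ∀ y : WeakDual.characterSpace ℂ D, y b = 0) : b = 0 := by
  have h1 : WeakDual.gelfandTransform ℂ (Unitization ℂ D) (b : Unitization ℂ D) = 0 := by
    ext χ
    change χ (b : Unitization ℂ D) = 0
    by_contra hχ
    -- A character of the unitization restricts to a multiplicative functional on `D`; it is nonzero
    -- because it does not kill `b`. The unital Gelfand transform can then be used.
    let f : D →L[ℂ] ℂ :=
      { toFun := fun c => χ (c : Unitization ℂ D)
        map_add' := fun c d => by rw [Unitization.inr_add, map_add]
        map_smul' := fun r c => by rw [Unitization.inr_smul, map_smul, RingHom.id_apply]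
        cont := (map_continuous χ).comp Unitization.isometry_inr.continuous }
    have hf : f ∈ WeakDual.characterSpace ℂ D := by
      refine ⟨fun h0 => hχ (DFunLike.congr_fun h0 b), fun c d => ?_⟩
      change χ ((c * d : D) : Unitization ℂ D) = χ (c : Unitization ℂ D) * χ (d : Unitization ℂ D)
      rw [Unitization.inr_mul, map_mul]
    exact hχ (h ⟨f, hf⟩)
  have h2 := (gelfandTransform_isometry (Unitization ℂ D)).injective
    (h1.trans (map_zero _).symm)
  exact Unitization.inr_injective (R := ℂ) (h2.trans (Unitization.inr_zero ℂ).symm)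

section CStar

variable {A : Type*} [NonUnitalCStarAlgebra A] {B : NonUnitalStarSubalgebra ℂ A} {m n : A}

namespace IsNondegenerateAbelian

theorem eq_zero_of_forall_apply (hB : IsNondegenerateAbelian B) (b : B)
    (h : ∀ y : GelfandSpectrum B, y b = 0) : b = 0 := by
  have hc : IsClosed (B : Set A) := hB.isClosed
  let _ : NonUnitalCommCStarAlgebra B :=
    { (inferInstance : NonUnitalCStarAlgebra B) with
      mul_comm := fun x y => Subtype.ext (hB.comm _ x.2 _ y.2) }
  exact NonUnitalCommCStarAlgebra.eq_zero_of_forall_character b h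

/-- For self-adjoint `t ∈ B`, some element of `B` is nonzero exactly where `t` is positive. -/
theorem exists_apply_ne_zero_iff (hB : IsNondegenerateAbelian B) (t : B) (ht : IsSelfAdjoint t) :
    ∃ b : B, ∀ y : GelfandSpectrum B, y b ≠ 0 ↔ 0 < (y t).re := by
  have hc : IsClosed (B : Set A) := hB.isClosed
  have ht' : IsSelfAdjoint (t : A) := congrArg Subtype.val ht
  have aux : ∀ f : ℝ → ℝ, cfcₙ f (t : A) ∈ B := fun f => cfcₙ_mem (𝕜' := ℂ) f t.2
  -- Since `Real.sqrt` vanishes on negative numbers, `x` and `x'` are the square roots of the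
  -- positive and negative parts of `t`. The identities `x² - x'² = t` and `x x' = 0` determine the
  -- sign of `y t` without evaluating characters on the functional calculus.
  let x : B := ⟨cfcₙ (fun s => Real.sqrt s) (t : A), aux _⟩
  let x' : B := ⟨cfcₙ (fun s => Real.sqrt (-s)) (t : A), aux _⟩
  have hx : IsSelfAdjoint x :=
    Subtype.ext (cfcₙ_predicate (R := ℝ) (p := IsSelfAdjoint) _ (t : A) : IsSelfAdjoint _)
  have hx' : IsSelfAdjoint x' :=
    Subtype.ext (cfcₙ_predicate (R := ℝ) (p := IsSelfAdjoint) _ (t : A) : IsSelfAdjoint _)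
  have hsub : x * x - x' * x' = t := by
    apply Subtype.ext
    change cfcₙ (fun s => Real.sqrt s) (t : A) * cfcₙ (fun s => Real.sqrt s) (t : A) -
      cfcₙ (fun s => Real.sqrt (-s)) (t : A) * cfcₙ (fun s => Real.sqrt (-s)) (t : A) = t
    rw [← cfcₙ_mul .., ← cfcₙ_mul .., ← cfcₙ_sub .., cfcₙ_congr (g := id), cfcₙ_id ..]
    intro s _
    rcases le_total 0 s with hs | hs
    · simp [Real.mul_self_sqrt hs, Real.sqrt_eq_zero_of_nonpos (neg_nonpos.2 hs)]
    · simp [Real.mul_self_sqrt (neg_nonneg.2 hs), Real.sqrt_eq_zero_of_nonpos hs]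
  have hmul : x * x' = 0 := by
    apply Subtype.ext
    change cfcₙ (fun s => Real.sqrt s) (t : A) * cfcₙ (fun s => Real.sqrt (-s)) (t : A) = 0
    rw [← cfcₙ_mul .., cfcₙ_congr (g := 0), cfcₙ_zero]
    intro s _
    rcases le_total 0 s with hs | hs
    · simp [Real.sqrt_eq_zero_of_nonpos (neg_nonpos.2 hs)]
    · simp [Real.sqrt_eq_zero_of_nonpos hs]
  refine ⟨x, fun y => ?_⟩
  obtain ⟨r, hr⟩ : ∃ r : ℝ, y x = r :=
    Complex.conj_eq_iff_real.1 (hB.conj_apply_of_isSelfAdjoint y hx)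
  obtain ⟨r', hr'⟩ : ∃ r : ℝ, y x' = r :=
    Complex.conj_eq_iff_real.1 (hB.conj_apply_of_isSelfAdjoint y hx')
  have h1 : r * r' = 0 := by
    have := congrArg y hmul
    rw [map_mul, map_zero, hr, hr'] at this
    exact_mod_cast this
  have h2 : (y t).re = r * r - r' * r' := by
    rw [← hsub, map_sub, map_mul, map_mul, hr, hr']
    norm_cast
  rw [h2, hr, Complex.ofReal_ne_zero]
  rcases mul_eq_zero.1 h1 with h | h
  · simp [h, mul_self_nonneg]
  · simp [h]

/-- The functions in `B` vanishing outside a given neighbourhood of a point of the spectrum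
separate that point from zero. -/
theorem exists_apply_ne_zero_of_mem_nhds (hB : IsNondegenerateAbelian B) {y : GelfandSpectrum B}
    {U : Set (GelfandSpectrum B)} (hU : U ∈ 𝓝 y) :
    ∃ b : B, y b ≠ 0 ∧ ∀ z ∉ U, z b = 0 := by
  obtain ⟨e, he⟩ : ∃ e : B, y e ≠ 0 := by
    by_contra! h
    exact y.2.1 (ContinuousLinearMap.ext h)
  -- The sets with the desired property form a filter, closed under intersection by multiplying the
  -- functions. As the spectrum carries the topology of pointwise convergence, it suffices that
  -- every evaluation converges along `F`.
  let F : Filter (GelfandSpectrum B) :=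
    { sets := {V | ∃ b : B, y b ≠ 0 ∧ ∀ z ∉ V, z b = 0}
      univ_sets := ⟨e, he, fun z hz => (hz trivial).elim⟩
      sets_of_superset := fun {V W} ⟨b, hb, h⟩ hVW =>
        ⟨b, hb, fun z hz => h z fun hz' => hz (hVW hz')⟩
      inter_sets := fun {V W} ⟨b, hb, h⟩ ⟨c, hc, h'⟩ => by
        refine ⟨b * c, by rw [map_mul]; exact mul_ne_zero hb hc, fun z hz => ?_⟩
        rw [map_mul]
        by_cases hV : z ∈ V
        · rw [h' z fun hW => hz ⟨hV, hW⟩, mul_zero]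
        · rw [h z hV, zero_mul] }
  have hF : F ≤ 𝓝 y := by
    have : Tendsto id F (𝓝 y) := by
      refine tendsto_subtype_rng.2
        (tendsto_iff_forall_eval_tendsto_topDualPairing.2 fun b => ?_)
      refine Metric.tendsto_nhds.2 fun ε hε => ?_
      -- With `e` in place of a unit, the function of `t` is `|e(z)|² (ε² - |b(z) - b(y)|²)`. It is
      -- positive at `y`, and only at points where `b` is within `ε` of `b(y)`.
      let c : B := e * b - y b • e
      let t : B := ((ε ^ 2 : ℝ) : ℂ) • (star e * e) - star c * c
      have ht : IsSelfAdjoint t :=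
        (IsSelfAdjoint.smul (r := ((ε ^ 2 : ℝ) : ℂ)) (Complex.conj_ofReal _)
          (IsSelfAdjoint.star_mul_self e)).sub
          (IsSelfAdjoint.star_mul_self c)
      have hval : ∀ z : GelfandSpectrum B,
          (z t).re = Complex.normSq (z e) * (ε ^ 2 - Complex.normSq (z b - y b)) := by
        intro z
        have h1 : z t = ((Complex.normSq (z e) *
            (ε ^ 2 - Complex.normSq (z b - y b)) : ℝ) : ℂ) := by
          simp only [t, c, map_sub, map_smul, map_mul, hB.apply_star, smul_eq_mul, star_sub,
            star_mul', Complex.ofReal_mul, Complex.ofReal_sub, Complex.normSq_eq_conj_mul_self,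
            Complex.star_def]
          ring
        rw [h1, Complex.ofReal_re]
      obtain ⟨d, hd⟩ := hB.exists_apply_ne_zero_iff t ht
      refine ⟨d, (hd y).2 ?_, fun z hz => ?_⟩
      · rw [hval]
        simpa using mul_pos (Complex.normSq_pos.2 he) (pow_pos hε 2)
      · by_contra h
        have h1 := (hd z).1 h
        rw [hval] at h1
        have h2 := pos_of_mul_pos_right h1 (Complex.normSq_nonneg _)
        refine hz ?_
        change dist (z b) (y b) < ε
        rw [Complex.normSq_eq_norm_sq, ← dist_eq_norm] at h2
        exact lt_of_pow_lt_pow_left₀ 2 hε.le (sub_pos.1 h2)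
    simpa [Tendsto] using this
  exact hF hU

end IsNondegenerateAbelian

/-! ### Maximality and the commutant -/

/-- A Cartan subalgebra contains its commutant. -/
theorem IsCartanSubalgebra.mem_of_commute (hB : IsCartanSubalgebra B) {a : A}
    (h : ∀ b ∈ B, b * a = a * b) : a ∈ B := by
  -- For self-adjoint `k` the set `S = B ∪ {k}` is commutative and self-adjoint, so `S ⊆ S'` and
  -- therefore `S'' ⊆ S'`. Thus `S''` is a closed commutative star subalgebra containing `B` and
  -- `k`, and maximality applies. The general case follows by splitting into real and imaginary
  -- parts.
  have hsa : ∀ k : A, IsSelfAdjoint k → (∀ b ∈ B, b * k = k * b) → k ∈ B := by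
    intro k hk hcomm
    let S : Set A := insert k B
    have hS : ∀ x ∈ S, ∀ y ∈ S, x * y = y * x := by
      rintro x (rfl | hx) y (rfl | hy)
      · rfl
      · exact (hcomm y hy).symm
      · exact hcomm x hx
      · exact hB.comm x hx y hy
    have hSs : ∀ x ∈ S, star x ∈ S := by
      rintro x (rfl | hx)
      · exact Or.inl hk
      · exact Or.inr (star_mem hx)
    have hSC : S ⊆ NonUnitalStarSubalgebra.centralizer ℂ S := fun x hx =>
      (NonUnitalStarSubalgebra.mem_centralizer_iff ℂ).2 fun g hg =>
        ⟨hS g hg x hx, hS _ (hSs g hg) x hx⟩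
    let C := NonUnitalStarSubalgebra.centralizer ℂ
      (NonUnitalStarSubalgebra.centralizer ℂ S : Set A)
    have hCS : C ≤ NonUnitalStarSubalgebra.centralizer ℂ S :=
      NonUnitalStarSubalgebra.centralizer_le ℂ _ _ hSC
    have hSC' : S ⊆ C := fun x hx =>
      (NonUnitalStarSubalgebra.mem_centralizer_iff ℂ).2 fun g hg =>
        have h1 : ∀ g' ∈ NonUnitalStarSubalgebra.centralizer ℂ S, g' * x = x * g' := fun g' hg' =>
          ((NonUnitalStarSubalgebra.mem_centralizer_iff ℂ).1 hg' x hx).1.symm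
        ⟨h1 g hg, h1 _ (star_mem hg)⟩
    have hC : C = B := hB.maximal C (Set.isClosed_centralizer _)
      (fun x hx y hy => ((NonUnitalStarSubalgebra.mem_centralizer_iff ℂ).1 hy x (hCS hx)).1)
      fun x hx => hSC' (Or.inr hx)
    rw [← hC]
    exact hSC' (Or.inl rfl)
  have h' : ∀ b ∈ B, b * star a = star a * b := fun b hb => by
    have := congrArg star (h (star b) (star_mem hb))
    simpa using this.symm
  have h1 : a + star a ∈ B := hsa _ (IsSelfAdjoint.add_star_self a) fun b hb => by
    rw [mul_add, add_mul, h b hb, h' b hb]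
  have h2 : Complex.I • (a - star a) ∈ B := by
    refine hsa _ ?_ fun b hb => ?_
    · rw [IsSelfAdjoint, star_smul, star_sub, star_star, Complex.star_def, Complex.conj_I,
        neg_smul, ← smul_neg, neg_sub]
    · rw [mul_smul_comm, smul_mul_assoc, mul_sub, sub_mul, h b hb, h' b hb]
  have h3 : a = (1 / 2 : ℂ) • (a + star a) -
      (Complex.I / 2) • (Complex.I • (a - star a)) := by
    rw [smul_smul, div_mul_eq_mul_div, Complex.I_mul_I]
    module
  rw [h3]
  exact sub_mem (SMulMemClass.smul_mem _ h1) (SMulMemClass.smul_mem _ h2)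

/-! ### Expectations of normalizers and fixed points -/

namespace IsConditionalExpectation

variable {P : A →ₗ[ℂ] B}

theorem apply_star_mul_self_nonneg (hP : IsConditionalExpectation B P)
    (hB : IsNondegenerateAbelian B) (y : GelfandSpectrum B) (a : A) :
    0 ≤ y (P (star a * a)) := by
  obtain ⟨c, hc⟩ := hP.positive a
  rw [hc, map_mul, hB.apply_star]
  exact star_mul_self_nonneg _

/-- If `P(n)(y) ≠ 0` then `y` lies in the domain of `n`. -/
theorem mem_dom (hP : IsConditionalExpectation B P) (hB : IsNondegenerateAbelian B)
    (hn : n ∈ cstarNormalizer B) {y : GelfandSpectrum B} (hy : y (P n) ≠ 0) : y ∈ hB.dom hn := by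
  rw [hB.mem_dom_iff]
  intro h0
  -- This is a Cauchy–Schwarz argument: once `n* n (y) = 0`, the `|z|²` term disappears and what
  -- remains cannot be non-negative for all `z`. The factor `P(n*)(y)` is kept as it stands, without
  -- identifying it with the conjugate of `P(n)(y)`.
  have key : ∀ z : ℂ, y (P (star (z • n + (P n : A)) * (z • n + (P n : A)))) =
      z * (star (y (P n)) * y (P n)) + star z * (y (P (star n)) * y (P n)) +
        star (y (P n)) * y (P n) := by
    intro z
    have e : star (z • n + (P n : A)) * (z • n + (P n : A)) =
        (star z * z) • ((hB.sq hn : B) : A) + z • (((star (P n) : B) : A) * n) +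
          star z • (star n * ((P n : B) : A)) + ((star (P n) * P n : B) : A) := by
      have : ((star (P n) : B) : A) = star (P n : A) := rfl
      simp only [star_add, star_smul, add_mul, mul_add, smul_mul_assoc, mul_smul_comm,
        IsNondegenerateAbelian.coe_sq, smul_add, smul_smul, NonUnitalStarSubalgebra.coe_mul, this]
      rw [mul_comm z]
      abel
    rw [e]
    simp only [map_add, map_smul, hP.apply_coe, hP.map_mul_left, hP.map_mul_right, map_mul,
      hB.apply_star, h0, smul_eq_mul]
    ring
  have hα : 0 < Complex.normSq (y (P n)) := Complex.normSq_pos.2 hy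
  have hα' : star (y (P n)) * y (P n) = (Complex.normSq (y (P n)) : ℂ) :=
    Complex.normSq_eq_conj_mul_self.symm
  -- Write `β = P(n*)(y) P(n)(y)`. For `z = i` the imaginary part must vanish, so `|P(n)(y)|² = Re
  -- β`; for `z = -1` the real part gives `Re β ≤ 0`.
  have h1 := hP.apply_star_mul_self_nonneg hB y (Complex.I • n + (P n : A))
  have h2 := hP.apply_star_mul_self_nonneg hB y ((-1 : ℂ) • n + (P n : A))
  rw [key, hα', Complex.le_def] at h1 h2
  generalize y (P (star n)) * y (P n) = β at h1 h2
  simp at h1 h2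
  linarith [h1.2, h2.1]

/-- Where `P(n)` does not vanish, `n* b n = b (n* n)`. -/
theorem apply_conjElem (hP : IsConditionalExpectation B P) (hB : IsNondegenerateAbelian B)
    (hn : n ∈ cstarNormalizer B) {y : GelfandSpectrum B} (hy : y (P n) ≠ 0) (b : B) :
    y (conjElem hn b) = y b * y (hB.sq hn) := by
  have h1 : n * star n ∈ B := by
    simpa using hB.star_mul_self_mem (star_mem_cstarNormalizer hn)
  -- Since `n n*` lies in the abelian `B`, `b` can be moved to the left. Applying `P` gives `P(n) ·
  -- n* b n = b · P(n) · n* n`, and `P(n)(y)` cancels.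
  have e : n * (conjElem hn b : A) = b * (n * (hB.sq hn : A)) := by
    calc n * (star n * b * n) = (n * star n) * b * n := by simp only [mul_assoc]
      _ = b * (n * (star n * n)) := by
        rw [hB.comm _ h1 _ b.2]
        simp only [mul_assoc]
  have e' := congrArg (fun a => y (P a)) e
  simp only [hP.map_mul_left, hP.map_mul_right, map_mul] at e'
  exact mul_left_cancel₀ hy (by linear_combination e')

theorem weylMap_eq_self (hP : IsConditionalExpectation B P) (hB : IsNondegenerateAbelian B)
    (hn : n ∈ cstarNormalizer B) {y : GelfandSpectrum B} (hy : y (P n) ≠ 0) :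
    hB.weylMap hn y = y := by
  have hd := hP.mem_dom hB hn hy
  have h0 := (hB.mem_dom_iff hn).1 hd
  rw [hB.weylMap_of_mem hn hd]
  ext b
  rw [IsNondegenerateAbelian.weylChar_apply, hP.apply_conjElem hB hn hy]
  field_simp

/-- Where `P(m* n)` does not vanish, `α_n = α_m`. -/
theorem weylMap_eq_of_apply_ne_zero (hP : IsConditionalExpectation B P)
    (hB : IsNondegenerateAbelian B) (hm : m ∈ cstarNormalizer B) (hn : n ∈ cstarNormalizer B)
    {y : GelfandSpectrum B} (hy : y (P (star m * n)) ≠ 0) :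
    hB.weylMap hn y = hB.weylMap hm y := by
  have hm' := star_mem_cstarNormalizer hm
  have hmn := mul_mem_cstarNormalizer hm' hn
  have hd := hP.mem_dom hB hmn hy
  -- `m* n` induces `α_m⁻¹ α_n`; as this map fixes `y`, applying `α_m` gives the claim.
  have h1 := hP.weylMap_eq_self hB hmn hy
  have h2 : hB.weylMap hmn y = hB.weylMap hm' (hB.weylMap hn y) :=
    (hB.weylHomeo_mul hm' hn).2 hd
  rw [hB.dom_mul hm' hn] at hd
  have h3 : hB.weylMap hm (hB.weylMap hm' (hB.weylMap hn y)) = hB.weylMap hn y :=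
    (hB.weylHomeo hm).right_inv hd.2
  rw [← h3, ← h2, h1]

theorem weylMap_eventuallyEq (hP : IsConditionalExpectation B P)
    (hB : IsNondegenerateAbelian B) (hm : m ∈ cstarNormalizer B) (hn : n ∈ cstarNormalizer B)
    {y : GelfandSpectrum B} (hy : y (P (star m * n)) ≠ 0) :
    hB.weylMap hn =ᶠ[𝓝 y] hB.weylMap hm := by
  filter_upwards [(IsNondegenerateAbelian.continuous_eval _).continuousAt.eventually_ne hy]
    with z hz using hP.weylMap_eq_of_apply_ne_zero hB hm hn hz

/-- At the interior points of the set of fixed points of `α_n`, the functions `|P(n)|²` and `n* n`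
coincide. -/
theorem star_mul_self_apply_eq_of_eventually_fixed (hP : IsConditionalExpectation B P)
    (hB : IsCartanSubalgebra B) (hn : n ∈ cstarNormalizer B) {y : GelfandSpectrum B}
    (h : ∀ᶠ z in 𝓝 y, z ∈ hB.dom hn ∧ hB.weylMap hn z = z) :
    star (y (P n)) * y (P n) = y (hB.sq hn) := by
  have hB' := hB.toIsNondegenerateAbelian
  obtain ⟨b, hb, hb'⟩ := hB'.exists_apply_ne_zero_of_mem_nhds h
  -- For `c ∈ B`, the commutator `d = c (n b) - (n b) c` has `d* d` in `B`, so it can be tested on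
  -- characters. Outside the fixed points `b` vanishes; at a fixed point `n* c n` has the value `c ·
  -- n* n`, and the four terms cancel.
  have hmem : n * (b : A) ∈ B := by
    refine hB.mem_of_commute fun c hc => ?_
    lift c to B using hc
    rw [← sub_eq_zero, ← CStarRing.star_mul_self_eq_zero_iff]
    have e : star ((c : A) * (n * b) - n * b * c) * ((c : A) * (n * b) - n * b * c) =
        ((star b * conjElem hn (star c * c) * b - star b * conjElem hn (star c) * (b * c)
          - star c * star b * conjElem hn c * b
          + star c * star b * hB'.sq hn * (b * c) : B) : A) := by
      have hstar : ∀ d : B, ((star d : B) : A) = star (d : A) := fun d => rfl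
      simp only [star_sub, star_mul, sub_mul, mul_sub, NonUnitalStarSubalgebra.coe_mul,
        AddMemClass.coe_add, AddSubgroupClass.coe_sub, coe_conjElem,
        IsNondegenerateAbelian.coe_sq, hstar, mul_assoc]
      abel
    rw [e]
    have h0 : (star b * conjElem hn (star c * c) * b - star b * conjElem hn (star c) * (b * c)
          - star c * star b * conjElem hn c * b
          + star c * star b * hB'.sq hn * (b * c) : B) = 0 := by
      refine hB'.eq_zero_of_forall_apply _ fun z => ?_
      by_cases hz : z ∈ hB'.dom hn ∧ hB'.weylMap hn z = z
      · have hs : ∀ d : B, z (conjElem hn d) = z d * z (hB'.sq hn) := fun d => by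
          have h1 := hB'.weylChar_spec hn z hz.1 d
          rwa [← hB'.weylMap_of_mem hn hz.1, hz.2] at h1
        simp only [map_add, map_sub, map_mul, hs]
        ring
      · have hz' : z b = 0 := hb' z hz
        simp only [map_add, map_sub, map_mul, hz']
        ring
    rw [h0]
    rfl
  -- As `n b ∈ B`, it is unchanged by `P`, so `P(n) b = n b`. Comparing `x* x` on both sides and
  -- cancelling `|b(y)|²` gives the result.
  have e1 : P n * b = ⟨n * (b : A), hmem⟩ := by
    rw [← hP.map_mul_right]
    exact hP.apply_coe ⟨n * (b : A), hmem⟩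
  have e2 : star (P n * b) * (P n * b) = star b * hB'.sq hn * b := by
    rw [e1]
    apply Subtype.ext
    change star (n * (b : A)) * (n * b) = star (b : A) * (star n * n) * b
    simp only [star_mul, mul_assoc]
  have e3 := congrArg y e2
  simp only [map_mul, hB'.apply_star, star_mul'] at e3
  exact mul_left_cancel₀ (mul_ne_zero (star_ne_zero.2 hb) hb) (by linear_combination e3)

end IsConditionalExpectation

/-! ### The Hausdorff property and separation by evaluated sections -/

theorem IsCartanSubalgebra.t2Space_weylGerm (hB : IsCartanSubalgebra B) :
    T2Space hB.toIsNondegenerateAbelian.WeylGerm := by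
  have hB' := hB.toIsNondegenerateAbelian
  obtain ⟨P, hP, -⟩ := hB.exists_expectation
  refine Pseudogroup.Germ.t2Space_of_eventually ?_
  rintro φ ⟨n, hn, hnφ⟩ ψ ⟨m, hm, hmψ⟩ y hyφ hyψ hφψ hne
  -- An element of the pseudogroup agrees with some `α_k` only on its domain, so germs have to be
  -- transferred between the two.
  have hgerm : ∀ {k : A} {hk : k ∈ cstarNormalizer B}
      {χ : OpenPartialHomeomorph (GelfandSpectrum B) (GelfandSpectrum B)} {z : GelfandSpectrum B},
      hB'.weylHomeo hk ≈ χ → z ∈ χ.source → hB'.weylMap hk =ᶠ[𝓝 z] χ := fun {k hk χ z} e hz =>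
    (e.2.eventuallyEq_of_mem ((hB'.weylHomeo hk).open_source.mem_nhds (by rwa [e.1])))
  have hm' := star_mem_cstarNormalizer hm
  have hmn := mul_mem_cstarNormalizer hm' hn
  have h0 : y (P (star m * n)) = 0 := by
    by_contra h
    exact hne ((hgerm hnφ hyφ).symm.trans
      ((hP.weylMap_eventuallyEq hB' hm hn h).trans (hgerm hmψ hyψ)))
  have hfix : ∀ z ∈ φ.source, z ∈ ψ.source → φ z = ψ z →
      z ∈ hB'.dom hmn ∧ hB'.weylMap hmn z = z := by
    intro z hzφ hzψ hz
    have hzn : z ∈ hB'.dom hn := by rwa [← hnφ.1] at hzφ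
    have hzm : z ∈ hB'.dom hm := by rwa [← hmψ.1] at hzψ
    have e : hB'.weylMap hn z = hB'.weylMap hm z :=
      (hnφ.2 hzn).trans (hz.trans (hmψ.2 hzm).symm)
    have hd : z ∈ hB'.dom hmn := by
      rw [hB'.dom_mul hm' hn]
      refine ⟨hzn, ?_⟩
      rw [Set.mem_preimage, e]
      exact (hB'.weylHomeo hm).map_source hzm
    refine ⟨hd, ?_⟩
    have h1 : hB'.weylMap hmn z = hB'.weylMap hm' (hB'.weylMap hn z) :=
      (hB'.weylHomeo_mul hm' hn).2 hd
    rw [h1, e]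
    exact (hB'.weylHomeo hm).left_inv hzm
  have hy0 := (hB'.mem_dom_iff hmn).1 (hfix y hyφ hyψ hφψ).1
  have hc : Continuous fun z : GelfandSpectrum B =>
      star (z (P (star m * n))) * z (P (star m * n)) - z (hB'.sq hmn) := by
    have h1 := IsNondegenerateAbelian.continuous_eval (P (star m * n))
    exact (h1.star.mul h1).sub (IsNondegenerateAbelian.continuous_eval _)
  -- At `y` the first term is zero because the germs differ, while the second is positive because
  -- `y` is fixed by `α_{m* n}`. By continuity the difference stays nonzero near `y`, whereas
  -- equality of germs at `z` would make `z` an interior fixed point and the difference zero.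
  have hcy : star (y (P (star m * n))) * y (P (star m * n)) - y (hB'.sq hmn) ≠ 0 := by
    simpa [h0] using hy0
  filter_upwards [hc.continuousAt.eventually_ne hcy] with z hz hzφ hzψ heq
  refine hz (sub_eq_zero.2 (hP.star_mul_self_apply_eq_of_eventually_fixed hB hmn ?_))
  filter_upwards [heq, φ.open_source.mem_nhds hzφ, ψ.open_source.mem_nhds hzψ]
    with w hw hwφ hwψ using hfix w hwφ hwψ hw

theorem IsConditionalExpectation.exists_eval_ne_zero {P : A →ₗ[ℂ] B}
    (hP : IsConditionalExpectation B P) (hB : IsNondegenerateAbelian B) {σ σ' : hB.WeylTwist}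
    (hne : σ.toGerm ≠ σ'.toGerm) : ∃ a : A, σ.eval hP a ≠ 0 ∧ σ'.eval hP a = 0 := by
  induction σ using Quotient.inductionOn with | _ σ
  induction σ' using Quotient.inductionOn with | _ τ
  have hσ := (hB.mem_dom_iff σ.mem).1 σ.y_mem
  have hval : ∀ b : B, σ.y b ≠ 0 → σ.eval P (σ.n * b) ≠ 0 := by
    intro b hb
    have e : P (star σ.n * (σ.n * (b : A))) = hB.sq σ.mem * b := by
      rw [← mul_assoc, ← hP.apply_coe (hB.sq σ.mem * b)]
      rfl
    have hpos : 0 < (σ.y (hB.sq σ.mem)).re := (Complex.pos_iff.1 σ.y_mem).1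
    rw [IsNondegenerateAbelian.WeylTriple.eval, e, map_mul]
    exact div_ne_zero (mul_ne_zero hσ hb)
      (Complex.ofReal_ne_zero.2 (Real.sqrt_pos.2 hpos).ne')
  have hzero : ∀ b : B, τ.y (P (star τ.n * σ.n)) * τ.y b = 0 →
      τ.eval P (σ.n * b) = 0 := by
    intro b hb
    rw [IsNondegenerateAbelian.WeylTriple.eval, ← mul_assoc, hP.map_mul_right, map_mul, hb, zero_div]
  by_cases hy : σ.y = τ.y
  -- Over the same point, any `b` with `b(y) ≠ 0` would do; `n* n` is one. The vanishing at the
  -- other class comes from `P(m* n)(y)`, which can be nonzero only if the germs coincide.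
  · refine ⟨σ.n * (hB.sq σ.mem : A), hval _ hσ, hzero _ ?_⟩
    by_contra h
    have h1 : σ.y (P (star τ.n * σ.n)) ≠ 0 := by
      rw [hy]
      exact left_ne_zero_of_mul h
    exact hne (Pseudogroup.Germ.germ_eq_iff.2
      ⟨hy, hP.weylMap_eventuallyEq hB τ.mem σ.mem h1⟩)
  -- Over different points, `b` is taken to vanish outside the complement of the second point, that
  -- is, at that point.
  · obtain ⟨b, hb, hb'⟩ := hB.exists_apply_ne_zero_of_mem_nhds (isOpen_ne.mem_nhds hy)
    refine ⟨σ.n * (b : A), hval b hb, hzero b ?_⟩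
    rw [hb' τ.y (fun h => h rfl), mul_zero]

end CStar

theorem mainTheorem7 {A : Type*} [NonUnitalCStarAlgebra A] [TopologicalSpace.SeparableSpace A]
    (B : NonUnitalStarSubalgebra ℂ A) (hB : IsCartanSubalgebra B) :
    T2Space hB.toIsNondegenerateAbelian.WeylGerm ∧
    hB.toIsNondegenerateAbelian.weylGroupoid.IsEtale ∧
    ∀ (P : A →ₗ[ℂ] B) (hP : IsConditionalExpectation B P), IsFaithfulExpectation P →
      ∀ σ σ' : hB.toIsNondegenerateAbelian.WeylTwist, σ.toGerm ≠ σ'.toGerm →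
        ∃ a : A, σ.eval hP a ≠ 0 ∧ σ'.eval hP a = 0 := by
  exact ⟨hB.t2Space_weylGerm, Pseudogroup.isEtale_germGroupoid _,
    fun P hP _ σ σ' hne => hP.exists_eval_ne_zero hB.toIsNondegenerateAbelian hne⟩
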